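/- Let $n,N\ge 0$ be integers. For a partition $R\vdash n$ let $V_R$ be the corresponding irreducible representation of $S_n$ and $d(R)$ its dimension, and let $\mathrm{Dim}_N(R)$ be the dimension of the representation of $U(N)$ labelled by $R$ (zero if $R$ has more than $N$ rows). Fix for every $R\vdash n$ a basis of $V_R$ in which $S_n$ acts by real orthogonal matrices $D^R(\sigma)$. For $R,S,T\vdash n$ let $\mathsf C(R,S,T)$ be the Kronecker coefficient (multiplicity of $V_T$ in $V_R\otimes V_S$), and let $C^{R,S;T,\tau}_{i_1,i_2;i_3}=\langle R,i_1;S,i_2|T,\tau,i_3\rangle$, $1\le\tau\le\mathsf C(R,S,T)$, be real Clebsch-Gordan coefficients, i.e. the components of an orthonormal basis $|T,\tau,i_3\rangle$ of $V_R\otimes V_S$ on which the diagonal action of $S_n$ is given by the matrices $D^T$. Put $\kappa_{R,S,T}=d(R)d(S)d(T)/(n!)^3$ and, for $1\le \tau,\tau'\le \mathsf C(R,S,T)$, $$Q^{R,S,T}_{\mathrm{un};\tau,\tau'}=\kappa_{R,S,T}\sum_{\sigma_1,\sigma_2,\sigma_3\in S_n}\sum_{i_l,j_l}C^{R,S;T,\tau}_{i_1,i_2;i_3}C^{R,S;T,\tau'}_{j_1,j_2;j_3}D^R_{i_1j_1}(\sigma_1)D^S_{i_2j_2}(\sigma_2)D^T_{i_3j_3}(\sigma_3)\,\sigma_1\otimes\sigma_2\otimes\sigma_3\in\mathbb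 C(S_n)^{\otimes 3}.$$ Let $\mathcal K(n)\subset\mathbb C(S_n)^{\otimes3}$ be the span of all $\sum_{\gamma_1,\gamma_2\in S_n}\gamma_1\sigma_1\gamma_2\otimes\gamma_1\sigma_2\gamma_2\otimes\gamma_1\sigma_3\gamma_2$. For a complex tensor $\Phi=(\Phi_{ijk})_{1\le i,j,k\le N}$ let $$\mathcal O_{\sigma_1,\sigma_2,\sigma_3}=\sum_{i_a,j_a,k_a}\ \prod_{a=1}^n\Phi_{i_aj_ak_a}\ \prod_{a=1}^n\bar\Phi_{i_{\sigma_1(a)}j_{\sigma_2(a)}k_{\sigma_3(a)}},$$ extend $\sigma_1\otimes\sigma_2\otimes\sigma_3\mapsto\mathcal O_{\sigma_1,\sigma_2,\sigma_3}$ linearly to $\mathbb C(S_n)^{\otimes 3}$, and let $\mathcal O^{R,S,T}_{\tau,\tau'}$ be the image of $Q^{R,S,T}_{\mathrm{un};\tau,\tau'}$. Let $\langle\mathcal O\,\overline{\mathcal O'}\rangle$ be the normal-ordered two-point function: the expectation of $:\!\mathcal O\!:\,\overline{:\!\mathcal O'\!:}$ in the Gaussian measure proportional to $e^{-\sum\Phi_{ijk}\bar\Phi_{ijk}}\,d\Phi\,d\bar\Phi$,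 where $:\!P\!:\,=e^{-\Delta}P$ with $\Delta=\sum_{i,j,k}\partial^2/\partial\Phi_{ijk}\partial\bar\Phi_{ijk}$ (no Wick contractions inside an observable). Then: (a) The elements $Q^{R,S,T}_{\mathrm{un};\tau,\tau'}$ form a basis of $\mathcal K(n)$, and $$Q^{R,S,T}_{\mathrm{un};\tau_1,\tau_2}\,Q^{R',S',T'}_{\mathrm{un};\tau_2',\tau_3}=d(T)\,\delta_{RR'}\delta_{SS'}\delta_{TT'}\delta_{\tau_2\tau_2'}\,Q^{R,S,T}_{\mathrm{un};\tau_1,\tau_3},$$ so that the elements $d(T)^{-1}Q^{R,S,T}_{\mathrm{un};\tau,\tau'}$ are matrix units of $\mathcal K(n)$. (b) For every $N$ the observables $\mathcal O^{R,S,T}_{\tau,\tau'}$ span the space spanned by all $\mathcal O_{\sigma_1,\sigma_2,\sigma_3}$, and they diagonalize the normal-ordered two-point function (the integrand being integrable): $$\big\langle\mathcal O^{R_1,S_1,T_1}_{\tau_1,\tau_1'}\,\overline{\mathcal O^{R_2,S_2,T_2}_{\tau_2,\tau_2'}}\big\rangle=\delta_{R_1R_2}\delta_{S_1S_2}\delta_{T_1T_2}\delta_{\tau_1\tau_2}\delta_{\tau_1'\tau_2'}\,(n!)^2\,d(T_1)^2\,\mathrm{Dim}_N(R_1)\,\mathrm{Dim}_N(S_1)\,\mathrm{Dim}_N(T_1).$$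 -/

import Mathlib

open scoped BigOperators Nat TensorProduct

namespace TensorModel

noncomputable section

/-! ### Irreducible representations of the symmetric group: Specht modules -/

/-- The Young diagram whose row lengths are the parts of the partition `R` of `n`. -/
def diagram {n : ℕ} (R : Nat.Partition n) : YoungDiagram :=
  YoungDiagram.ofRowLens (R.parts.sort (· ≥ ·)) (Multiset.pairwise_sort _ _).sortedGE

/-- A (bijective) Young tableau of shape `R`: the entry `i` is put in the box `t i`
(row `(t i).1.1`, column `(t i).1.2`). -/
abbrev Tableau {n : ℕ} (R : Nat.Partition n) : Type := Fin n ≃ (diagram R).cells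

/-- The permutation representation of `S_n` on formal complex combinations of tabloids. A tabloid
is recorded by the function that sends each entry to the index of its row. -/
def tabloidRep (n : ℕ) :
    Representation ℂ (Equiv.Perm (Fin n)) ((Fin n → ℕ) →₀ ℂ) where
  toFun σ := Finsupp.lmapDomain ℂ ℂ (fun r : Fin n → ℕ => fun i => r (σ⁻¹ i))
  map_one' := by
    ext r
    simp
  map_mul' σ τ := by
    ext r
    simp

/-- The polytabloid `e_t = ∑_q sign(q) q{t}`, where `q` runs over the column stabiliser of `t`. -/
def polytabloid {n : ℕ} {R : Nat.Partition n} (t : Tableau R) : (Fin n → ℕ) →₀ ℂ :=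
  ∑ q : Equiv.Perm (Fin n) with ∀ i, (t (q i)).1.2 = (t i).1.2,
    Finsupp.single (fun i => (t (q⁻¹ i)).1.1) ((Equiv.Perm.sign q : ℤ) : ℂ)

theorem tabloidRep_polytabloid {n : ℕ} {R : Nat.Partition n} (σ : Equiv.Perm (Fin n))
    (t : Tableau R) :
    tabloidRep n σ (polytabloid t) = polytabloid (R := R) ((σ⁻¹ : Equiv.Perm (Fin n)).trans t) := by
  simp only [polytabloid, map_sum]
  refine Finset.sum_bij' (fun q _ => σ * q * σ⁻¹) (fun q _ => σ⁻¹ * q * σ) ?_ ?_ ?_ ?_ ?_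
  · intro q hq
    simp only [Finset.mem_filter, Finset.mem_univ, true_and] at hq ⊢
    intro i
    simpa using hq (σ⁻¹ i)
  · intro q hq
    simp only [Finset.mem_filter, Finset.mem_univ, true_and] at hq ⊢
    intro i
    simpa using hq (σ i)
  · intro q _
    group
  · intro q _
    group
  · intro q _
    have hs : Equiv.Perm.sign (σ * q * σ⁻¹) = Equiv.Perm.sign q := by
      rw [map_mul, map_mul, map_inv, mul_right_comm, mul_inv_cancel, one_mul]
    rw [hs]
    simp [tabloidRep]

/-- The Specht module of `R`: the span of all polytabloids of shape `R`. -/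
def specht {n : ℕ} (R : Nat.Partition n) : Subrepresentation (tabloidRep n) where
  toSubmodule := Submodule.span ℂ (Set.range (polytabloid (R := R)))
  apply_mem_toSubmodule σ v hv := by
    induction hv using Submodule.span_induction with
    | mem x hx =>
      obtain ⟨t, rfl⟩ := hx
      rw [tabloidRep_polytabloid]
      exact Submodule.subset_span ⟨_, rfl⟩
    | zero => simp
    | add x y _ _ hx hy => rw [map_add]; exact Submodule.add_mem _ hx hy
    | smul a x _ hx => rw [map_smul]; exact Submodule.smul_mem _ a hx

/-- The space `V_R` of the irreducible representation of `S_n` labelled by `R`. -/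
abbrev SpechtModule {n : ℕ} (R : Nat.Partition n) : Type := (specht R).toSubmodule

/-- The irreducible representation of `S_n` labelled by `R`. -/
def spechtRep {n : ℕ} (R : Nat.Partition n) :
    Representation ℂ (Equiv.Perm (Fin n)) (SpechtModule R) :=
  (specht R).toRepresentation

/-- `d(R)`, the dimension of the irreducible representation `R` of `S_n`. -/
def dimS {n : ℕ} (R : Nat.Partition n) : ℕ := Module.finrank ℂ (SpechtModule R)

/-- The Kronecker coefficient: the multiplicity of `V_T` in `V_R ⊗ V_S`. -/
def kron {n : ℕ} (R S T : Nat.Partition n) : ℕ :=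
  Module.finrank ℂ
    (Representation.IntertwiningMap (spechtRep T) ((spechtRep R).tprod (spechtRep S)))

/-! ### Irreducible representations of the unitary group: Weyl modules -/

/-- The space `(ℂ^N)^{⊗ n}`. -/
abbrev TensorPower (n N : ℕ) : Type := ⨂[ℂ] _ : Fin n, (Fin N → ℂ)

/-- The action of `S_n` on `(ℂ^N)^{⊗ n}` by permutation of the tensor factors. -/
def permTensorRep (n N : ℕ) : Representation ℂ (Equiv.Perm (Fin n)) (TensorPower n N) where
  toFun σ := (PiTensorProduct.reindex ℂ (fun _ : Fin n => (Fin N → ℂ)) σ).toLinearMap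
  map_one' := by
    refine PiTensorProduct.ext (MultilinearMap.ext fun v => ?_)
    exact PiTensorProduct.reindex_tprod (R := ℂ) (s := fun _ : Fin n => (Fin N → ℂ)) 1 v
  map_mul' σ τ := by
    refine PiTensorProduct.ext (MultilinearMap.ext fun v => ?_)
    change PiTensorProduct.reindex ℂ (fun _ : Fin n => (Fin N → ℂ)) (σ * τ)
        (PiTensorProduct.tprod ℂ v) =
      PiTensorProduct.reindex ℂ (fun _ : Fin n => (Fin N → ℂ)) σ
        (PiTensorProduct.reindex ℂ (fun _ : Fin n => (Fin N → ℂ)) τ (PiTensorProduct.tprod ℂ v))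
    rw [PiTensorProduct.reindex_tprod, PiTensorProduct.reindex_tprod]
    exact (PiTensorProduct.reindex_tprod (R := ℂ) (s := fun _ : Fin n => (Fin N → ℂ)) σ
      (fun i => v (τ.symm i))).symm

/-- The action `g ↦ g^{⊗ n}` of `U(N)` on `(ℂ^N)^{⊗ n}`; it commutes with that of `S_n`. -/
def unitaryPower (n N : ℕ) (g : Matrix.unitaryGroup (Fin N) ℂ) :
    Representation.IntertwiningMap (permTensorRep n N) (permTensorRep n N) where
  toLinearMap := PiTensorProduct.map fun _ => Matrix.toLin' (g : Matrix (Fin N) (Fin N) ℂ)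
  isIntertwining' σ := by
    ext v
    simp [permTensorRep]

/-- The Weyl module: the multiplicity space of `V_R` in `(ℂ^N)^{⊗ n}`, in Schur-Weyl duality. -/
abbrev WeylModule {n : ℕ} (N : ℕ) (R : Nat.Partition n) : Type :=
  Representation.IntertwiningMap (spechtRep R) (permTensorRep n N)

/-- The representation of `U(N)` labelled by `R` (it is zero if `R` has more than `N` rows). -/
def weylRep {n : ℕ} (N : ℕ) (R : Nat.Partition n) :
    Representation ℂ (Matrix.unitaryGroup (Fin N) ℂ) (WeylModule N R) where
  toFun g :=
    { toFun := fun f => (unitaryPower n N g).comp f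
      map_add' := fun f f' => by ext v; simp
      map_smul' := fun a f => by ext v; simp }
  map_one' := by
    ext f v
    simp [unitaryPower]
  map_mul' g h := by
    ext f v
    simp [unitaryPower, Matrix.toLin'_mul, PiTensorProduct.map_comp]

/-- `Dim_N(R)`, the dimension of the representation `R` of `U(N)`. -/
def dimU {n : ℕ} (N : ℕ) (R : Nat.Partition n) : ℕ := Module.finrank ℂ (WeylModule N R)

/-! ### Orthogonal matrix forms and Clebsch-Gordan coefficients -/

/-- A choice, for every `R ⊢ n`, of a basis of `V_R` in which the permutations act by real
orthogonal matrices `D^R(σ)`. -/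
structure OrthogonalForm (n : ℕ) where
  basis : ∀ R : Nat.Partition n, Module.Basis (Fin (dimS R)) ℂ (SpechtModule R)
  D : ∀ R : Nat.Partition n,
    Equiv.Perm (Fin n) → Matrix (Fin (dimS R)) (Fin (dimS R)) ℝ
  toMatrix_eq : ∀ R σ,
    LinearMap.toMatrix (basis R) (basis R) (spechtRep R σ) = (D R σ).map Complex.ofReal
  orthogonal : ∀ R σ, D R σ ∈ Matrix.orthogonalGroup (Fin (dimS R)) ℝ

/-- Clebsch-Gordan coefficients: for all `R, S`, an orthonormal basis `|T, τ, i₃⟩` of the real span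
of the states `|R, i₁; S, i₂⟩`, with `τ` running over the multiplicity of `T` in `R ⊗ S`,
in which the diagonal action of `S_n` is given by the matrices `D^T`. -/
structure ClebschGordan {n : ℕ} (B : OrthogonalForm n) where
  state : ∀ R S : Nat.Partition n,
    OrthonormalBasis (Σ T : Nat.Partition n, Fin (kron R S T) × Fin (dimS T)) ℝ
      (EuclideanSpace ℝ (Fin (dimS R) × Fin (dimS S)))
  equivariant : ∀ (R S T : Nat.Partition n) (τ : Fin (kron R S T)) (σ : Equiv.Perm (Fin n))
    (i₁ : Fin (dimS R)) (i₂ : Fin (dimS S)) (j₃ : Fin (dimS T)),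
    ∑ j₁, ∑ j₂, B.D R σ i₁ j₁ * B.D S σ i₂ j₂ * state R S ⟨T, τ, j₃⟩ (j₁, j₂)
      = ∑ i₃, state R S ⟨T, τ, i₃⟩ (i₁, i₂) * B.D T σ i₃ j₃

/-- The coefficient `C^{R,S;T,τ}_{i₁,i₂;i₃} = ⟨R, i₁; S, i₂ | T, τ, i₃⟩`. -/
def ClebschGordan.coeff {n : ℕ} {B : OrthogonalForm n} (C : ClebschGordan B)
    (R S T : Nat.Partition n) (τ : Fin (kron R S T))
    (i₁ : Fin (dimS R)) (i₂ : Fin (dimS S)) (i₃ : Fin (dimS T)) : ℝ :=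
  C.state R S ⟨T, τ, i₃⟩ (i₁, i₂)

/-! ### The double coset algebra and its Fourier basis -/

/-- `S_n × S_n × S_n`. -/
abbrev Perm3 (n : ℕ) : Type :=
  Equiv.Perm (Fin n) × Equiv.Perm (Fin n) × Equiv.Perm (Fin n)

/-- `ℂ(S_n)^{⊗ 3}`, realised as the group algebra of `S_n × S_n × S_n`. -/
abbrev Alg3 (n : ℕ) : Type := MonoidAlgebra ℂ (Perm3 n)

/-- `γ^{⊗ 3}`. -/
def diag {n : ℕ} (γ : Equiv.Perm (Fin n)) : Perm3 n := (γ, γ, γ)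

/-- The double coset form of `𝒦(n)`: the span of the sums of
`γ₁ σ₁ γ₂ ⊗ γ₁ σ₂ γ₂ ⊗ γ₁ σ₃ γ₂` over `γ₁, γ₂`. -/
def doubleCosetSpace (n : ℕ) : Submodule ℂ (Alg3 n) :=
  Submodule.span ℂ (Set.range fun σ : Perm3 n =>
    ∑ γ₁ : Equiv.Perm (Fin n), ∑ γ₂ : Equiv.Perm (Fin n),
      MonoidAlgebra.single (diag γ₁ * σ * diag γ₂) (1 : ℂ))

/-- Triples `(R, S, T)` of partitions of `n`. -/
abbrev Triple (n : ℕ) : Type := Nat.Partition n × Nat.Partition n × Nat.Partition n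

/-- The range of the multiplicity labels of a triple. -/
abbrev Mult {n : ℕ} (p : Triple n) : Type := Fin (kron p.1 p.2.1 p.2.2)

/-- Labels `(R, S, T, τ, τ')` of the Fourier basis. -/
abbrev Label (n : ℕ) : Type := Σ p : Triple n, Mult p × Mult p

/-- `κ_{R,S,T} = d(R) d(S) d(T) / (n!)³`. -/
def kappa {n : ℕ} (p : Triple n) : ℝ :=
  (dimS p.1 * dimS p.2.1 * dimS p.2.2 : ℝ) / (n ! : ℝ) ^ 3

/-- The coefficient of `σ₁ ⊗ σ₂ ⊗ σ₃` in `Q_un^{R,S,T}_{τ,τ'}`. -/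
def QunCoeff {n : ℕ} {B : OrthogonalForm n} (C : ClebschGordan B) (p : Triple n) (τ τ' : Mult p)
    (σ : Perm3 n) : ℝ :=
  kappa p * ∑ i₁, ∑ i₂, ∑ i₃, ∑ j₁, ∑ j₂, ∑ j₃,
    C.coeff p.1 p.2.1 p.2.2 τ i₁ i₂ i₃ * C.coeff p.1 p.2.1 p.2.2 τ' j₁ j₂ j₃ *
      B.D p.1 σ.1 i₁ j₁ * B.D p.2.1 σ.2.1 i₂ j₂ * B.D p.2.2 σ.2.2 i₃ j₃

/-- The Fourier basis element `Q_un^{R,S,T}_{τ,τ'}`. -/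
def Qun {n : ℕ} {B : OrthogonalForm n} (C : ClebschGordan B) (p : Triple n) (τ τ' : Mult p) :
    Alg3 n :=
  ∑ σ : Perm3 n, MonoidAlgebra.single σ (QunCoeff C p τ τ' σ : ℂ)

/-! ### Tensor observables and the Gaussian model -/

/-- The index set of the components of a rank 3 tensor of size `N`. -/
abbrev Idx (N : ℕ) : Type := Fin N × Fin N × Fin N

/-- Polynomials in the components `Φ_x` (variables `Sum.inl x`) and `Φ̄_x` (variables
`Sum.inr x`). -/
abbrev TensorPoly (N : ℕ) : Type := MvPolynomial (Idx N ⊕ Idx N) ℂ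

/-- The observable `O_{σ₁,σ₂,σ₃}`: the contraction of `n` copies of `Φ` with `n` copies of `Φ̄`,
the `a`-th copy of `Φ` having indices `(i_a, j_a, k_a)` and the `a`-th copy of `Φ̄` having indices
`(i_{σ₁(a)}, j_{σ₂(a)}, k_{σ₃(a)})`. -/
def permObservable {n : ℕ} (N : ℕ) (σ : Perm3 n) : TensorPoly N :=
  ∑ x : Fin n → Idx N,
    (∏ a, MvPolynomial.X (Sum.inl (x a))) *
      ∏ a, MvPolynomial.X (Sum.inr ((x (σ.1 a)).1, (x (σ.2.1 a)).2.1, (x (σ.2.2 a)).2.2))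

/-- The linear extension of `σ₁ ⊗ σ₂ ⊗ σ₃ ↦ O_{σ₁,σ₂,σ₃}` to `ℂ(S_n)^{⊗ 3}`. -/
def observable {n : ℕ} (N : ℕ) : Alg3 n →ₗ[ℂ] TensorPoly N :=
  Finsupp.linearCombination ℂ (permObservable N) ∘ₗ
    (MonoidAlgebra.coeffLinearEquiv (M := Perm3 n) (S := ℂ) ℂ).toLinearMap

/-- The Fourier basis observable `O^{R,S,T}_{τ,τ'}`. -/
def fourierObservable {n : ℕ} {B : OrthogonalForm n} (C : ClebschGordan B) (N : ℕ)
    (a : Label n) : TensorPoly N :=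
  observable N (Qun C a.1 a.2.1 a.2.2)

/-- The value of a polynomial observable at a tensor `Φ`, with `Φ̄` its complex conjugate. -/
def evalAt {N : ℕ} (P : TensorPoly N) (Φ : Idx N → ℂ) : ℂ :=
  MvPolynomial.eval (Sum.elim Φ fun x => starRingEnd ℂ (Φ x)) P

/-- The self-contraction operator `Δ = ∑_x ∂²/∂Φ_x ∂Φ̄_x`. -/
def contraction {N : ℕ} (P : TensorPoly N) : TensorPoly N :=
  ∑ x : Idx N, MvPolynomial.pderiv (Sum.inl x) (MvPolynomial.pderiv (Sum.inr x) P)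

/-- Normal ordering with respect to the propagator `⟨Φ_x Φ̄_y⟩ = δ_{xy}`, which removes all
self-contractions: `:P: = exp(-Δ) P`. As `Δ` lowers degrees, the terms left out vanish. -/
def normalOrder {N : ℕ} (P : TensorPoly N) : TensorPoly N :=
  ∑ k ∈ Finset.range (P.totalDegree + 1), ((-1 : ℂ) ^ k / (k ! : ℂ)) • (contraction^[k] P)

/-- The Gaussian weight `exp(-∑_x Φ_x Φ̄_x)`. -/
def gaussianWeight {N : ℕ} (Φ : Idx N → ℂ) : ℂ :=
  Complex.exp (-∑ x, Φ x * starRingEnd ℂ (Φ x))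

/-- The Gaussian expectation value of a function of the tensor. -/
def gaussianExpectation {N : ℕ} (F : (Idx N → ℂ) → ℂ) : ℂ :=
  (∫ Φ : Idx N → ℂ, F Φ * gaussianWeight Φ) / ∫ Φ : Idx N → ℂ, gaussianWeight Φ

/-- The function `:P: (Φ) · conj (:P': (Φ))`. -/
def normalOrderedProduct {N : ℕ} (P P' : TensorPoly N) (Φ : Idx N → ℂ) : ℂ :=
  evalAt (normalOrder P) Φ * starRingEnd ℂ (evalAt (normalOrder P') Φ)

/-- The normal-ordered Gaussian two-point function `⟨P conj(P')⟩`. -/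
def twoPoint {N : ℕ} (P P' : TensorPoly N) : ℂ :=
  gaussianExpectation (normalOrderedProduct P P')

end

end TensorModel

/-! The theorem is Fourier analysis on `S_n × S_n × S_n` relative to its diagonal subgroup. The
matrix elements of all `V_R ⊗ V_S ⊗ V_T` are orthogonal and span the functions on the group
(`sum_D3_mul_D3`, `exists_sum_D3_eq_delta`). Summing over the diagonal subgroup projects `V_R ⊗ V_S
⊗ V_T`, up to a scalar, onto its invariants, and the Clebsch-Gordan vectors `vec p τ` are an
orthogonal basis of these, each of squared norm `d(T)` (`sum_D3_diag`, `sum_vec_mul_vec`). Hence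
two-sided averages of matrix elements are combinations of matrix coefficients between two such
vectors, which are the `Qun` up to the factor `kappa`; this gives the span. Schur orthogonality
gives the product rule, with `d(T)` as a squared norm, and the product rule gives linear
independence.

The facts needed about Specht modules are that equivariant maps vanish between different shapes and
are scalars on a single shape (`intertwiner_eq_zero`, `intertwiner_eq_smul`). They come from column
antisymmetrisers, with the sum of the row indices in the role of the dominance order. Completeness
follows because there are as many orthogonal characters as partitions of `n`.

For the observables, relabelling the copies of `Φ` and of `Φ̄` gives invariance under two-sided
diagonal translations, so nothing is lost by passing to `𝒦(n)`. Normal ordering `e^{-Δ}` turns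
multiplication by a variable `X u` into `X u - ∂`, where `∂` differentiates in the conjugate
variable. Combined with Gaussian integration by parts this leaves only pairings between the two
observables: a permutation `α` pairs the `Φ` of one with the `Φ̄` of the other, and `β` does the
reverse. A pairing contributes one count of fixed index assignments per tensor slot, each count
being the character of `S_n` on `(ℂ^N)^{⊗ n}` (`twoPoint_permObservable`,
`character_permTensorRep`).

On Fourier observables the pairings are absorbed by invariance and give `(n!)²`. What remains is the
linear functional with weights `fixCount3`, applied to a product of two `Qun`
(`twoPoint_fourierObservable`). Schur's lemma evaluates it in terms of the multiplicities `dimU`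
(`sum_fixCount3_mul_QunCoeff`). One factor `d(T)` comes from the product, the other from the
functional. -/

namespace TensorModel

noncomputable section

section

/-! ### Column antisymmetrisers and homomorphisms between Specht modules -/

/-- The row of each entry of a tableau. -/
def rowOf {n : ℕ} {R : Nat.Partition n} (t : Tableau R) : Fin n → ℕ := fun i => (t i).1.1

/-- The column stabiliser of a tableau. -/
def colStab {n : ℕ} {R : Nat.Partition n} (t : Tableau R) : Finset (Equiv.Perm (Fin n)) :=
  {q : Equiv.Perm (Fin n) | ∀ i, (t (q i)).1.2 = (t i).1.2}

/-- The column antisymmetriser of a tableau. -/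
def colAntisym {n : ℕ} {R : Nat.Partition n} (t : Tableau R) :
    ((Fin n → ℕ) →₀ ℂ) →ₗ[ℂ] ((Fin n → ℕ) →₀ ℂ) :=
  ∑ q ∈ colStab t, ((Equiv.Perm.sign q : ℤ) : ℂ) • tabloidRep n q

variable {n : ℕ} {R S : Nat.Partition n}

theorem mem_colStab {t : Tableau R} {q : Equiv.Perm (Fin n)} :
    q ∈ colStab t ↔ ∀ i, (t (q i)).1.2 = (t i).1.2 := by
  simp [colStab]

theorem mul_mem_colStab {t : Tableau R} {p q : Equiv.Perm (Fin n)} (hp : p ∈ colStab t)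
    (hq : q ∈ colStab t) : p * q ∈ colStab t := by
  rw [mem_colStab] at *
  intro i
  rw [Equiv.Perm.mul_apply, hp, hq]

theorem inv_mem_colStab {t : Tableau R} {q : Equiv.Perm (Fin n)} (hq : q ∈ colStab t) :
    q⁻¹ ∈ colStab t := by
  rw [mem_colStab] at *
  intro i
  simpa using (hq (q⁻¹ i)).symm

theorem tabloidRep_single (σ : Equiv.Perm (Fin n)) (r : Fin n → ℕ) (c : ℂ) :
    tabloidRep n σ (Finsupp.single r c) = Finsupp.single (fun i => r (σ⁻¹ i)) c := by
  simp [tabloidRep]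

theorem colAntisym_apply (t : Tableau R) (x : (Fin n → ℕ) →₀ ℂ) :
    colAntisym t x = ∑ q ∈ colStab t, ((Equiv.Perm.sign q : ℤ) : ℂ) • tabloidRep n q x := by
  simp [colAntisym]

theorem colAntisym_single_rowOf (t : Tableau R) :
    colAntisym t (Finsupp.single (rowOf t) 1) = polytabloid t := by
  rw [colAntisym_apply, polytabloid]
  refine Finset.sum_congr rfl fun q _ => ?_
  rw [tabloidRep_single, Finsupp.smul_single, smul_eq_mul, mul_one]
  rfl

/-- A column antisymmetriser absorbs the elements of the column stabiliser up to sign. -/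
theorem colAntisym_tabloidRep {t : Tableau R} {p : Equiv.Perm (Fin n)} (hp : p ∈ colStab t)
    (x : (Fin n → ℕ) →₀ ℂ) :
    colAntisym t (tabloidRep n p x) = ((Equiv.Perm.sign p : ℤ) : ℂ) • colAntisym t x := by
  rw [colAntisym_apply, colAntisym_apply, Finset.smul_sum]
  refine Finset.sum_bij' (fun q _ => q * p) (fun q _ => q * p⁻¹) ?_ ?_ ?_ ?_ ?_
  · intro q hq
    exact mul_mem_colStab hq hp
  · intro q hq
    exact mul_mem_colStab hq (inv_mem_colStab hp)
  · intro q _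
    group
  · intro q _
    group
  · intro q _
    rw [smul_smul, map_mul (tabloidRep n), Module.End.mul_apply]
    congr 1
    rcases Int.units_eq_one_or (Equiv.Perm.sign p) with h | h <;> simp [h]

/-- The transposition of `a` and `b` lies in the column stabiliser and fixes the tabloid, so its odd
sign forces the image to equal its own negative. -/
theorem colAntisym_eq_zero_of_not_injOn {t : Tableau R} {r : Fin n → ℕ} {a b : Fin n}
    (hab : a ≠ b) (hc : (t a).1.2 = (t b).1.2) (hr : r a = r b) (c : ℂ) :
    colAntisym t (Finsupp.single r c) = 0 := by
  have hs : Equiv.swap a b ∈ colStab t := by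
    rw [mem_colStab]
    intro i
    by_cases h : i = a
    · simp [h, hc]
    · by_cases h' : i = b
      · simp [h', hc]
      · rw [Equiv.swap_apply_of_ne_of_ne h h']
  have h := colAntisym_tabloidRep hs (Finsupp.single r c)
  have hf : (fun i => r ((Equiv.swap a b)⁻¹ i)) = r := by
    funext i
    rw [Equiv.swap_inv]
    by_cases h : i = a
    · simp [h, hr]
    · by_cases h' : i = b
      · simp [h', hr]
      · rw [Equiv.swap_apply_of_ne_of_ne h h']
  rw [tabloidRep_single, hf, Equiv.Perm.sign_swap hab] at h
  simpa [self_eq_neg] using h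

theorem colAntisym_polytabloid (t : Tableau R) :
    colAntisym t (polytabloid t) = ((colStab t).card : ℂ) • polytabloid t := by
  rw [← colAntisym_single_rowOf]
  conv_lhs => rw [colAntisym_apply t (Finsupp.single (rowOf t) 1), map_sum]
  rw [Finset.sum_congr rfl fun q hq => ?_, Finset.sum_const, ← Nat.cast_smul_eq_nsmul ℂ]
  rw [map_smul, colAntisym_tabloidRep hq, smul_smul]
  rcases Int.units_eq_one_or (Equiv.Perm.sign q) with h | h <;> simp [h]

/-- The number of boxes in a column, counted by the entries of a tableau. -/
theorem card_filter_col (t : Tableau R) (c : ℕ) :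
    (Finset.univ.filter fun i => (t i).1.2 = c).card = (diagram R).colLen c := by
  rw [YoungDiagram.colLen_eq_card]
  refine Finset.card_bij (fun i _ => (t i).1) ?_ ?_ ?_
  · intro i hi
    rw [YoungDiagram.mem_col_iff]
    exact ⟨(t i).2, (Finset.mem_filter.1 hi).2⟩
  · intro i _ j _ h
    exact t.injective (Subtype.ext h)
  · intro b hb
    rw [YoungDiagram.mem_col_iff] at hb
    exact ⟨t.symm ⟨b, hb.1⟩, by simp [hb.2], by simp⟩

/-- A row function which is injective on the columns of a tableau has at least the same sum as the
row function of the tableau, with equality only for column permutations. -/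
theorem sum_rowOf_le_of_injOn (t : Tableau R) (r : Fin n → ℕ)
    (hr : ∀ a b, (t a).1.2 = (t b).1.2 → r a = r b → a = b) :
    ∑ i, rowOf t i ≤ ∑ i, r i ∧
      (∑ i, r i ≤ ∑ i, rowOf t i → ∃ q ∈ colStab t, r = fun i => rowOf t (q i)) := by
  classical
  -- `p i` is the rank of `r i` among the values of `r` on the column of `i`. Ranks fill each column
  -- exactly from the top, so `p` is the row function of a column rearrangement of `t`, while `p ≤
  -- r` pointwise.
  set p : Fin n → ℕ := fun i =>
    (Finset.univ.filter fun j => (t j).1.2 = (t i).1.2 ∧ r j < r i).card with hp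
  have hpr : ∀ i, p i ≤ r i := by
    intro i
    rw [← Finset.card_range (r i)]
    refine Finset.card_le_card_of_injOn r ?_ ?_
    · intro j hj
      simp only [Finset.coe_filter, Finset.mem_univ, true_and, Set.mem_ofPred_eq] at hj
      simpa using hj.2
    · intro a ha b hb h
      simp only [Finset.coe_filter, Finset.mem_univ, true_and, Set.mem_ofPred_eq] at ha hb
      exact hr a b (ha.1.trans hb.1.symm) h
  have hmono : ∀ i j, (t i).1.2 = (t j).1.2 → r i < r j → p i < p j := by
    intro i j hij h
    refine Finset.card_lt_card (Finset.ssubset_iff_of_subset ?_ |>.2 ⟨i, ?_, ?_⟩)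
    · intro k hk
      simp only [Finset.mem_filter, Finset.mem_univ, true_and] at hk ⊢
      exact ⟨hk.1.trans hij, hk.2.trans h⟩
    · simp [hij, h]
    · simp
  have hinj : ∀ i j, (t i).1.2 = (t j).1.2 → p i = p j → i = j := by
    intro i j hij h
    rcases lt_trichotomy (r i) (r j) with h1 | h1 | h1
    · exact absurd h (hmono i j hij h1).ne
    · exact hr i j hij h1
    · exact absurd h (hmono j i hij.symm h1).ne'
  have hmem : ∀ i, (p i, (t i).1.2) ∈ (diagram R).cells := by
    intro i
    rw [YoungDiagram.mem_cells, YoungDiagram.mem_iff_lt_colLen, ← card_filter_col t]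
    refine Finset.card_lt_card (Finset.ssubset_iff_of_subset ?_ |>.2 ⟨i, ?_, ?_⟩)
    · intro k hk
      simp only [Finset.mem_filter, Finset.mem_univ, true_and] at hk ⊢
      exact hk.1
    · simp
    · simp
  set f : Fin n → Fin n := fun i => t.symm ⟨(p i, (t i).1.2), hmem i⟩ with hf
  have htf : ∀ i, (t (f i)).1 = (p i, (t i).1.2) := by
    intro i
    simp [hf]
  have hfinj : Function.Injective f := by
    intro i j h
    have h1 := htf i
    rw [h, htf j, Prod.mk.injEq] at h1
    exact hinj i j h1.2.symm h1.1.symm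
  let q : Equiv.Perm (Fin n) := Equiv.ofBijective f (Finite.injective_iff_bijective.1 hfinj)
  have hpq : ∀ i, p i = rowOf t (q i) := by
    intro i
    have := congrArg Prod.fst (htf i)
    exact this.symm
  have hsum : ∑ i, p i = ∑ i, rowOf t i := by
    rw [Finset.sum_congr rfl fun i _ => hpq i, Equiv.sum_comp q]
  refine ⟨hsum ▸ Finset.sum_le_sum fun i _ => hpr i, fun hle => ⟨q, ?_, ?_⟩⟩
  · rw [mem_colStab]
    intro i
    have := congrArg Prod.snd (htf i)
    exact this
  · funext i
    rw [← hpq]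
    -- Equality of the sums together with `p ≤ r` forces `p = r`.
    have heq : ∑ i, p i = ∑ i, r i :=
      le_antisymm (Finset.sum_le_sum fun i _ => hpr i) (hsum ▸ hle)
    exact ((Finset.sum_eq_sum_iff_of_le fun i _ => hpr i).1 heq i (Finset.mem_univ i)).symm

/-- The sum of the row indices of the boxes of a diagram. -/
def rowSum (R : Nat.Partition n) : ℕ := ∑ c ∈ (diagram R).cells, c.1

theorem sum_rowOf (t : Tableau R) : ∑ i, rowOf t i = rowSum R := by
  rw [rowSum, ← Finset.sum_coe_sort (diagram R).cells]
  exact Equiv.sum_comp t fun c => c.1.1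

/-- A tabloid that survives the antisymmetriser is injective on the columns of `t`, hence has row
sum at least that of `R`. Any two shapes are comparable by row sum, so this number can replace the
dominance order. -/
theorem colAntisym_single_rowOf_eq_zero (t : Tableau R) (s : Tableau S)
    (h : rowSum S < rowSum R) : colAntisym t (Finsupp.single (rowOf s) 1) = 0 := by
  by_cases hr : ∀ a b, (t a).1.2 = (t b).1.2 → rowOf s a = rowOf s b → a = b
  · have := (sum_rowOf_le_of_injOn t _ hr).1
    rw [sum_rowOf, sum_rowOf] at this
    omega
  · push Not at hr
    obtain ⟨a, b, hc, he, hab⟩ := hr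
    exact colAntisym_eq_zero_of_not_injOn hab hc he 1

theorem colAntisym_single_rowOf_of_rowSum_eq (t : Tableau R) (s : Tableau S)
    (h : rowSum S = rowSum R) : colAntisym t (Finsupp.single (rowOf s) 1) = 0 ∨
      ∃ q ∈ colStab t, rowOf s = fun i => rowOf t (q i) := by
  by_cases hr : ∀ a b, (t a).1.2 = (t b).1.2 → rowOf s a = rowOf s b → a = b
  · right
    refine (sum_rowOf_le_of_injOn t _ hr).2 ?_
    rw [sum_rowOf, sum_rowOf, h]
  · push Not at hr
    obtain ⟨a, b, hc, he, hab⟩ := hr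
    exact Or.inl (colAntisym_eq_zero_of_not_injOn hab hc he 1)

theorem diagram_injective : Function.Injective (diagram : Nat.Partition n → YoungDiagram) := by
  intro R S h
  have key : ∀ R : Nat.Partition n, (diagram R).rowLens = R.parts.sort (· ≥ ·) := fun R =>
    YoungDiagram.rowLens_ofRowLens_eq_self fun x hx => R.parts_pos ((Multiset.mem_sort _).1 hx)
  have h' := congrArg YoungDiagram.rowLens h
  rw [key, key] at h'
  ext1
  rw [← Multiset.sort_eq R.parts (· ≥ ·), h', Multiset.sort_eq]

theorem card_filter_rowOf (t : Tableau R) (c : ℕ) :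
    (Finset.univ.filter fun i => rowOf t i = c).card = (diagram R).rowLen c := by
  rw [YoungDiagram.rowLen_eq_card]
  refine Finset.card_bij (fun i _ => (t i).1) ?_ ?_ ?_
  · intro i hi
    rw [YoungDiagram.mem_row_iff]
    exact ⟨(t i).2, (Finset.mem_filter.1 hi).2⟩
  · intro i _ j _ h
    exact t.injective (Subtype.ext h)
  · intro b hb
    rw [YoungDiagram.mem_row_iff] at hb
    exact ⟨t.symm ⟨b, hb.1⟩, by rw [Finset.mem_filter]; simp [rowOf, hb.2], by simp⟩

theorem eq_of_rowOf_eq_comp {t : Tableau R} {s : Tableau S} {q : Equiv.Perm (Fin n)}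
    (h : rowOf s = fun i => rowOf t (q i)) : R = S := by
  apply diagram_injective
  have hlen : ∀ c, (diagram R).rowLen c = (diagram S).rowLen c := by
    intro c
    rw [← card_filter_rowOf t, ← card_filter_rowOf s, h]
    refine (Finset.card_equiv q fun i => ?_).symm
    simp
  ext ⟨i, j⟩
  rw [YoungDiagram.mem_cells, YoungDiagram.mem_cells, YoungDiagram.mem_iff_lt_rowLen,
    YoungDiagram.mem_iff_lt_rowLen, hlen]

/-- Specht modules consist of combinations of tabloids of the right shape. -/
theorem mem_span_of_mem_specht {x : (Fin n → ℕ) →₀ ℂ} (hx : x ∈ (specht S).toSubmodule) :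
    x ∈ Submodule.span ℂ (Set.range fun s : Tableau S => Finsupp.single (rowOf s) (1 : ℂ)) := by
  refine (Submodule.span_le.2 ?_ :
    Submodule.span ℂ (Set.range (polytabloid (R := S))) ≤ _) hx
  rintro _ ⟨t, rfl⟩
  rw [← colAntisym_single_rowOf, colAntisym_apply]
  refine Submodule.sum_mem _ fun q _ => Submodule.smul_mem _ _ (Submodule.subset_span ?_)
  refine ⟨(q⁻¹ : Equiv.Perm (Fin n)).trans t, ?_⟩
  rw [tabloidRep_single]
  rfl

/-- A tabloid of shape `S` that survived would have row sum equal to that of `R`, hence would be a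
column rearrangement of `t`; its row lengths would then force `R = S`. -/
theorem colAntisym_eq_zero_of_mem_specht (t : Tableau R) (hne : R ≠ S)
    (h : rowSum S ≤ rowSum R) {x : (Fin n → ℕ) →₀ ℂ} (hx : x ∈ (specht S).toSubmodule) :
    colAntisym t x = 0 := by
  have hx' := mem_span_of_mem_specht hx
  clear hx
  induction hx' using Submodule.span_induction with
  | mem x hx =>
    obtain ⟨s, rfl⟩ := hx
    rcases h.lt_or_eq with h | h
    · exact colAntisym_single_rowOf_eq_zero t s h
    · refine (colAntisym_single_rowOf_of_rowSum_eq t s h).resolve_right ?_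
      rintro ⟨q, -, hq⟩
      exact hne (eq_of_rowOf_eq_comp hq)
  | zero => simp
  | add x y _ _ hx hy => rw [map_add, hx, hy, add_zero]
  | smul a x _ hx => rw [map_smul, hx, smul_zero]

/-- The surviving tabloids of shape `R` are column rearrangements of that of `t`, and the
antisymmetriser absorbs the rearrangement up to sign. So it has rank at most one on the Specht
module. -/
theorem colAntisym_mem_span_of_mem_specht (t : Tableau R) {x : (Fin n → ℕ) →₀ ℂ}
    (hx : x ∈ (specht R).toSubmodule) :
    colAntisym t x ∈ Submodule.span ℂ {polytabloid t} := by
  have hx' := mem_span_of_mem_specht hx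
  clear hx
  induction hx' using Submodule.span_induction with
  | mem x hx =>
    obtain ⟨s, rfl⟩ := hx
    rcases colAntisym_single_rowOf_of_rowSum_eq t s rfl with h | ⟨q, hq, h⟩
    · simp [h]
    · have h2 : Finsupp.single (rowOf s) (1 : ℂ)
          = tabloidRep n q⁻¹ (Finsupp.single (rowOf t) 1) := by
        rw [tabloidRep_single, inv_inv, h]
      simp only [h2]
      rw [colAntisym_tabloidRep (inv_mem_colStab hq), colAntisym_single_rowOf]
      exact Submodule.smul_mem _ _ (Submodule.mem_span_singleton_self _)
  | zero => simp
  | add x y _ _ hx hy => rw [map_add]; exact Submodule.add_mem _ hx hy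
  | smul a x _ hx => rw [map_smul]; exact Submodule.smul_mem _ _ hx

/-- The polytabloid of `t` as an element of the Specht module. -/
def spechtGen (t : Tableau R) : SpechtModule R :=
  ⟨polytabloid t, Submodule.subset_span ⟨t, rfl⟩⟩

theorem spechtRep_spechtGen (σ : Equiv.Perm (Fin n)) (t : Tableau R) :
    spechtRep R σ (spechtGen t) = spechtGen (R := R) ((σ⁻¹ : Equiv.Perm (Fin n)).trans t) :=
  Subtype.ext (tabloidRep_polytabloid σ t)

theorem span_spechtGen : Submodule.span ℂ (Set.range (spechtGen (R := R))) = ⊤ := by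
  have h := Submodule.span_span_coe_preimage (R := ℂ) (s := Set.range (polytabloid (R := R)))
  have h2 : Set.range (spechtGen (R := R)) =
      ((↑) : Submodule.span ℂ (Set.range (polytabloid (R := R))) → _) ⁻¹'
        Set.range (polytabloid (R := R)) := ?_
  · exact h2 ▸ h
  ext v
  constructor
  · rintro ⟨t, rfl⟩
    exact ⟨t, rfl⟩
  · rintro ⟨t, ht⟩
    exact ⟨t, Subtype.ext ht⟩

theorem card_colStab_ne_zero (t : Tableau R) : ((colStab t).card : ℂ) ≠ 0 := by
  rw [Nat.cast_ne_zero]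
  exact Finset.card_ne_zero_of_mem (a := 1) (mem_colStab.2 fun i => rfl)

/-- The image of a polytabloid under an equivariant map is determined by its antisymmetrisation. -/
theorem coe_map_spechtGen (f : SpechtModule R →ₗ[ℂ] SpechtModule S)
    (hf : ∀ σ v, f (spechtRep R σ v) = spechtRep S σ (f v)) (t : Tableau R) :
    colAntisym t (f (spechtGen t) : (Fin n → ℕ) →₀ ℂ)
      = ((colStab t).card : ℂ) • (f (spechtGen t) : (Fin n → ℕ) →₀ ℂ) := by
  have h1 : (∑ q ∈ colStab t, ((Equiv.Perm.sign q : ℤ) : ℂ) • spechtRep R q (spechtGen t))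
      = ((colStab t).card : ℂ) • spechtGen t := by
    apply Subtype.ext
    rw [Submodule.coe_smul, Submodule.coe_sum]
    have := colAntisym_polytabloid t
    rw [colAntisym_apply] at this
    exact this
  have h2 := congrArg (fun v => (f v : (Fin n → ℕ) →₀ ℂ)) h1
  simp only [map_sum, map_smul, hf, Submodule.coe_smul, Submodule.coe_sum] at h2
  rw [colAntisym_apply, ← h2]
  rfl

/-- The antisymmetriser of `t` acts on the image of the polytabloid of `t` both as zero and as the
nonzero order of the column stabiliser. Only one ordering of the row sums is covered; transposition
of orthogonal matrices supplies the other in `matrix_eq_zero`. -/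
theorem intertwiner_eq_zero (hne : R ≠ S) (h : rowSum S ≤ rowSum R)
    (f : SpechtModule R →ₗ[ℂ] SpechtModule S)
    (hf : ∀ σ v, f (spechtRep R σ v) = spechtRep S σ (f v)) : f = 0 := by
  refine LinearMap.ext_on_range span_spechtGen fun t => Subtype.ext ?_
  have h1 := coe_map_spechtGen f hf t
  rw [colAntisym_eq_zero_of_mem_specht t hne h (f (spechtGen t)).2] at h1
  simpa [card_colStab_ne_zero t] using h1.symm

/-- The image of one polytabloid stays on its line because the antisymmetriser has rank at most one,
and the permutations carry this polytabloid to all generators. Neither irreducibility nor the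
existence of an eigenvalue is used. -/
theorem intertwiner_eq_smul (f : SpechtModule R →ₗ[ℂ] SpechtModule R)
    (hf : ∀ σ v, f (spechtRep R σ v) = spechtRep R σ (f v)) :
    ∃ c : ℂ, ∀ v, f v = c • v := by
  rcases isEmpty_or_nonempty (Tableau R) with hE | ⟨⟨t₀⟩⟩
  · refine ⟨0, fun v => ?_⟩
    have : f = 0 := LinearMap.ext_on_range span_spechtGen fun t => hE.elim t
    simp [this]
  have h1 := coe_map_spechtGen f hf t₀
  have h2 := colAntisym_mem_span_of_mem_specht t₀ (f (spechtGen t₀)).2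
  rw [h1, Submodule.smul_mem_iff _ (card_colStab_ne_zero t₀), Submodule.mem_span_singleton] at h2
  obtain ⟨c, hc⟩ := h2
  have hc' : f (spechtGen t₀) = c • spechtGen t₀ := Subtype.ext hc.symm
  refine ⟨c, fun v => ?_⟩
  have : f = c • LinearMap.id := by
    refine LinearMap.ext_on_range span_spechtGen fun t => ?_
    have ht : t = ((t.trans t₀.symm : Equiv.Perm (Fin n))).trans t₀ := by
      ext i : 1
      simp
    have h3 := spechtRep_spechtGen (t.trans t₀.symm : Equiv.Perm (Fin n))⁻¹ t₀
    rw [inv_inv, ← ht] at h3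
    rw [← h3, hf, hc']
    simp
  simp [this]

/-! ### Specht modules are nonzero. -/

theorem card_diagram (R : Nat.Partition n) : (diagram R).cells.card = n := by
  have key : ∀ w : List ℕ, (YoungDiagram.cellsOfRowLens w).card = w.sum := by
    intro w
    induction w with
    | nil => simp [YoungDiagram.cellsOfRowLens]
    | cons a w ih =>
      rw [YoungDiagram.cellsOfRowLens, Finset.card_union_of_disjoint, Finset.card_map, ih]
      · simp
      · rw [Finset.disjoint_left]
        rintro ⟨i, j⟩ h1 h2
        simp at h1 h2
        omega
  have : (diagram R).cells = YoungDiagram.cellsOfRowLens (R.parts.sort (· ≥ ·)) := rfl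
  rw [this, key, ← Multiset.sum_coe, Multiset.sort_eq, R.parts_sum]

instance (R : Nat.Partition n) : Nonempty (Tableau R) :=
  ⟨Fintype.equivOfCardEq (by rw [Fintype.card_fin, Fintype.card_coe, card_diagram])⟩

/-- The tabloid of `t` occurs with coefficient one: a permutation preserving both the row and the
column of every entry is the identity. -/
theorem spechtGen_ne_zero (t : Tableau R) : spechtGen t ≠ 0 := by
  intro h
  have h0 : polytabloid t = 0 := congrArg Subtype.val h
  have h1 := DFunLike.congr_fun h0 (rowOf t)
  rw [polytabloid, Finsupp.finsetSum_apply, Finset.sum_eq_single 1] at h1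
  · rw [Finsupp.single_apply, if_pos (by funext i; simp [rowOf])] at h1
    simp at h1
  · intro q hq hq1
    rw [Finsupp.single_apply, if_neg]
    intro he
    apply hq1
    have hq' := mem_colStab.1 (inv_mem_colStab hq)
    refine inv_eq_one.1 (Equiv.ext fun i => t.injective (Subtype.ext (Prod.ext ?_ ?_)))
    · exact congrFun he i
    · exact hq' i
  · intro h
    simp at h

theorem dimS_pos (B : OrthogonalForm n) (R : Nat.Partition n) : 0 < dimS R := by
  obtain ⟨t⟩ := (inferInstance : Nonempty (Tableau R))
  by_contra h
  have : IsEmpty (Fin (dimS R)) := by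
    rw [Nat.eq_zero_of_not_pos h]
    infer_instance
  refine spechtGen_ne_zero t ((B.basis R).repr.injective (Finsupp.ext fun i => this.elim i))

end

section

/-! ### Schur orthogonality and completeness of the matrix elements -/

namespace OrthogonalForm

variable {n : ℕ} (B : OrthogonalForm n) {R S : Nat.Partition n}

theorem D_mul (R : Nat.Partition n) (σ τ : Equiv.Perm (Fin n)) :
    B.D R (σ * τ) = B.D R σ * B.D R τ := by
  have h : (B.D R (σ * τ)).map Complex.ofReal = (B.D R σ * B.D R τ).map Complex.ofReal := by
    rw [← B.toMatrix_eq, map_mul, LinearMap.toMatrix_mul, B.toMatrix_eq, B.toMatrix_eq]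
    exact (Matrix.map_mul (f := Complex.ofRealHom)).symm
  exact Matrix.map_injective Complex.ofReal_injective h

theorem D_one (R : Nat.Partition n) : B.D R 1 = 1 := by
  have h : (B.D R 1).map Complex.ofReal = (1 : Matrix _ _ ℝ).map Complex.ofReal := by
    rw [← B.toMatrix_eq, map_one, LinearMap.toMatrix_one, Matrix.map_one _ (by simp) (by simp)]
  exact Matrix.map_injective Complex.ofReal_injective h

theorem D_mul_transpose (R : Nat.Partition n) (σ : Equiv.Perm (Fin n)) :
    B.D R σ * (B.D R σ).transpose = 1 :=
  (Matrix.mem_orthogonalGroup_iff _ _).1 (B.orthogonal R σ)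

theorem D_inv (R : Nat.Partition n) (σ : Equiv.Perm (Fin n)) :
    B.D R σ⁻¹ = (B.D R σ).transpose := by
  have h : B.D R σ⁻¹ * B.D R σ = 1 := by rw [← B.D_mul, inv_mul_cancel, B.D_one]
  calc B.D R σ⁻¹ = B.D R σ⁻¹ * (B.D R σ * (B.D R σ).transpose) := by
        rw [B.D_mul_transpose, mul_one]
    _ = _ := by rw [← mul_assoc, h, one_mul]

theorem D_inv_apply (R : Nat.Partition n) (σ : Equiv.Perm (Fin n)) (i j : Fin (dimS R)) :
    B.D R σ⁻¹ i j = B.D R σ j i := by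
  rw [B.D_inv, Matrix.transpose_apply]

theorem D_mul_apply (R : Nat.Partition n) (σ τ : Equiv.Perm (Fin n)) (i j : Fin (dimS R)) :
    B.D R (σ * τ) i j = ∑ k, B.D R σ i k * B.D R τ k j := by
  rw [B.D_mul, Matrix.mul_apply]

/-- The equivariant map with a given matrix. -/
theorem toLin_intertwines (A : Matrix (Fin (dimS S)) (Fin (dimS R)) ℝ)
    (hA : ∀ σ, A * B.D R σ = B.D S σ * A) (σ : Equiv.Perm (Fin n)) (v : SpechtModule R) :
    Matrix.toLin (B.basis R) (B.basis S) (A.map Complex.ofReal) (spechtRep R σ v)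
      = spechtRep S σ (Matrix.toLin (B.basis R) (B.basis S) (A.map Complex.ofReal) v) := by
  have h : Matrix.toLin (B.basis R) (B.basis S) (A.map Complex.ofReal) ∘ₗ spechtRep R σ
      = spechtRep S σ ∘ₗ Matrix.toLin (B.basis R) (B.basis S) (A.map Complex.ofReal) := by
    apply (LinearMap.toMatrix (B.basis R) (B.basis S)).injective
    rw [LinearMap.toMatrix_comp _ (B.basis R), LinearMap.toMatrix_comp _ (B.basis S),
      LinearMap.toMatrix_toLin, B.toMatrix_eq, B.toMatrix_eq]
    have := congrArg (fun M => Matrix.map M Complex.ofRealHom) (hA σ)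
    simp only [Matrix.map_mul] at this
    exact this
  exact LinearMap.congr_fun h v

theorem matrix_eq_zero_of_rowSum_le (hne : R ≠ S) (h : rowSum S ≤ rowSum R)
    (A : Matrix (Fin (dimS S)) (Fin (dimS R)) ℝ) (hA : ∀ σ, A * B.D R σ = B.D S σ * A) :
    A = 0 := by
  have h0 := intertwiner_eq_zero hne h _ (B.toLin_intertwines A hA)
  rw [LinearEquiv.map_eq_zero_iff] at h0
  exact Matrix.map_injective Complex.ofReal_injective (h0.trans (by ext; simp))

/-- Schur's lemma for distinct partitions. -/
theorem matrix_eq_zero (hne : R ≠ S) (A : Matrix (Fin (dimS S)) (Fin (dimS R)) ℝ)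
    (hA : ∀ σ, A * B.D R σ = B.D S σ * A) : A = 0 := by
  rcases le_total (rowSum S) (rowSum R) with h | h
  · exact B.matrix_eq_zero_of_rowSum_le hne h A hA
  -- As the matrices are orthogonal, the transpose of an intertwiner is an intertwiner in the
  -- opposite direction.
  · have hT := B.matrix_eq_zero_of_rowSum_le hne.symm h A.transpose fun σ => by
      have := congrArg Matrix.transpose (hA σ⁻¹)
      rw [Matrix.transpose_mul, Matrix.transpose_mul, B.D_inv, B.D_inv, Matrix.transpose_transpose,
        Matrix.transpose_transpose] at this
      exact this.symm
    exact Matrix.transpose_eq_zero.1 hT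

/-- Schur's lemma for a single partition. -/
theorem matrix_eq_smul_one (A : Matrix (Fin (dimS R)) (Fin (dimS R)) ℝ)
    (hA : ∀ σ, A * B.D R σ = B.D R σ * A) (i j : Fin (dimS R)) :
    A i j = if i = j then A i i else 0 := by
  split_ifs with hij
  · rw [hij]
  · obtain ⟨c, hc⟩ := intertwiner_eq_smul _ (B.toLin_intertwines A hA)
    have h := congrArg (fun v => (B.basis R).repr v i) (hc (B.basis R j))
    simpa [Matrix.toLin_self, Finsupp.single_apply, Ne.symm hij] using h

theorem matrix_diag_eq (A : Matrix (Fin (dimS R)) (Fin (dimS R)) ℝ)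
    (hA : ∀ σ, A * B.D R σ = B.D R σ * A) (i j : Fin (dimS R)) : A i i = A j j := by
  obtain ⟨c, hc⟩ := intertwiner_eq_smul _ (B.toLin_intertwines A hA)
  have h : ∀ i, (A i i : ℂ) = c := fun i => by
    have h := congrArg (fun v => (B.basis R).repr v i) (hc (B.basis R i))
    simpa [Matrix.toLin_self, Finsupp.single_apply] using h
  exact_mod_cast (h i).trans (h j).symm

/-- Averages of products of matrix elements. -/
def overlap (R S : Nat.Partition n) (j : Fin (dimS S)) (l : Fin (dimS R)) :
    Matrix (Fin (dimS S)) (Fin (dimS R)) ℝ :=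
  Matrix.of fun i k => ∑ g, B.D S g i j * B.D R g k l

theorem overlap_intertwines (j : Fin (dimS S)) (l : Fin (dimS R)) (σ : Equiv.Perm (Fin n)) :
    B.overlap R S j l * B.D R σ = B.D S σ * B.overlap R S j l := by
  ext i k
  simp only [Matrix.mul_apply, overlap, Matrix.of_apply, Finset.sum_mul, Finset.mul_sum]
  rw [Finset.sum_comm, Finset.sum_comm (f := fun x g => B.D S σ i x * _)]
  rw [← Equiv.sum_comp (Equiv.mulLeft σ)]
  refine Finset.sum_congr rfl fun g _ => ?_
  simp only [Equiv.coe_mulLeft, mul_assoc]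
  rw [← Finset.mul_sum]
  have h1 : ∑ m, B.D R (σ * g) m l * B.D R σ m k = B.D R g k l := by
    simp_rw [mul_comm _ (B.D R σ _ k), ← B.D_inv_apply R σ k]
    rw [← B.D_mul_apply, inv_mul_cancel_left]
  rw [h1, B.D_mul_apply, Finset.sum_mul]
  exact Finset.sum_congr rfl fun x _ => mul_assoc _ _ _

theorem sum_D_mul_D_of_ne (hne : R ≠ S) (i j : Fin (dimS R)) (k l : Fin (dimS S)) :
    ∑ g, B.D R g i j * B.D S g k l = 0 :=
  congrFun (congrFun (B.matrix_eq_zero hne.symm _ (B.overlap_intertwines j l)) i) k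

theorem sum_D_mul_D (R : Nat.Partition n) (i j k l : Fin (dimS R)) :
    ∑ g, B.D R g i j * B.D R g k l = if i = k ∧ j = l then (n ! : ℝ) / dimS R else 0 := by
  set F : Fin (dimS R) → Fin (dimS R) → Fin (dimS R) → Fin (dimS R) → ℝ :=
    fun i j k l => ∑ g, B.D R g i j * B.D R g k l with hF
  have h1 : ∀ i j k l, F i j k l = if i = k then F i j i l else 0 := fun i j k l =>
    B.matrix_eq_smul_one _ (B.overlap_intertwines j l) i k
  have h2 : ∀ i j k l, F i j i l = F k j k l := fun i j k l =>
    B.matrix_diag_eq _ (B.overlap_intertwines j l) i k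
  -- Inversion of the summation variable transposes the matrices, so Schur's lemma applies to the
  -- column indices as well as to the row indices.
  have h3 : ∀ i j k l, F i j k l = F j i l k := by
    intro i j k l
    simp only [hF]
    rw [← Equiv.sum_comp (Equiv.inv _)]
    simp [B.D_inv_apply]
  have h4 : ∀ i j, F i j i j = (n ! : ℝ) / dimS R := by
    intro i j
    -- Rows of orthogonal matrices are unit vectors; the `d(R)` summands are all equal, which fixes
    -- the constant.
    have h5 : ∑ j, F i j i j = n ! := by
      simp only [hF]
      rw [Finset.sum_comm]
      have : ∀ g, ∑ j, B.D R g i j * B.D R g i j = 1 := by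
        intro g
        have := congrFun (congrFun (B.D_mul_transpose R g) i) i
        simpa [Matrix.mul_apply] using this
      simp [this, Fintype.card_perm]
    have h6 : ∀ j', F i j' i j' = F i j i j := fun j' => by rw [h3, h2 j' i j i, h3]
    rw [Finset.sum_congr rfl fun j' _ => h6 j'] at h5
    simp only [Finset.sum_const, Finset.card_univ, Fintype.card_fin, nsmul_eq_mul] at h5
    rw [eq_div_iff (by exact_mod_cast (dimS_pos B R).ne'), mul_comm, h5]
  change F i j k l = _
  by_cases hik : i = k
  · subst hik
    by_cases hjl : j = l
    · subst hjl
      simp [h4]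
    · rw [h3, h1, if_neg hjl, if_neg (by tauto)]
  · rw [h1, if_neg hik, if_neg (by tauto)]

/-- The character of `R`. -/
def chi (R : Nat.Partition n) (g : Equiv.Perm (Fin n)) : ℝ := ∑ i, B.D R g i i

theorem chi_eq_trace (R : Nat.Partition n) (g : Equiv.Perm (Fin n)) :
    B.chi R g = (B.D R g).trace := rfl

theorem chi_eq_of_isConj (R : Nat.Partition n) {g h : Equiv.Perm (Fin n)} (hgh : IsConj g h) :
    B.chi R g = B.chi R h := by
  obtain ⟨c, rfl⟩ := isConj_iff.1 hgh
  rw [chi_eq_trace, chi_eq_trace, B.D_mul, Matrix.trace_mul_comm, ← B.D_mul, inv_mul_cancel_left]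

theorem sum_chi_mul_chi (R S : Nat.Partition n) :
    ∑ g, B.chi R g * B.chi S g = if R = S then (n ! : ℝ) else 0 := by
  simp only [chi, Finset.sum_mul_sum]
  rw [Finset.sum_comm]
  simp_rw [Finset.sum_comm (s := (Finset.univ : Finset (Equiv.Perm (Fin n))))]
  split_ifs with h
  · subst h
    have hd : (dimS R : ℝ) ≠ 0 := by exact_mod_cast (dimS_pos B R).ne'
    simp only [sum_D_mul_D, and_self]
    simp
    field_simp
  · simp [B.sum_D_mul_D_of_ne h]

/-- The delta function at the identity is a combination of characters. -/
theorem exists_sum_chi_eq_delta :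
    ∃ a : Nat.Partition n → ℝ, ∀ g, ∑ R, a R * B.chi R g = if g = 1 then 1 else 0 := by
  classical
  -- The characters are viewed as functions of the cycle type. The default value `0` is harmless:
  -- `f` is only evaluated at cycle types of actual permutations.
  let f : Nat.Partition n → Nat.Partition (Fintype.card (Fin n)) → ℝ := fun R π =>
    if h : ∃ σ : Equiv.Perm (Fin n), σ.partition = π then B.chi R h.choose else 0
  have hf : ∀ R (g : Equiv.Perm (Fin n)), f R g.partition = B.chi R g := by
    intro R g
    have h : ∃ σ : Equiv.Perm (Fin n), σ.partition = g.partition := ⟨g, rfl⟩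
    simp only [f, dif_pos h]
    exact B.chi_eq_of_isConj R (Equiv.Perm.partition_eq_of_isConj.2 h.choose_spec)
  have hli : LinearIndependent ℝ f := by
    rw [Fintype.linearIndependent_iff]
    intro c hc S
    have h0 : ∀ g, ∑ R, c R * B.chi R g = 0 := by
      intro g
      have := congrFun hc g.partition
      simpa [hf] using this
    have h1 : ∑ g, (∑ R, c R * B.chi R g) * B.chi S g = c S * n ! := by
      simp_rw [Finset.sum_mul, mul_assoc]
      rw [Finset.sum_comm]
      simp_rw [← Finset.mul_sum, sum_chi_mul_chi]
      simp
    simp only [h0, zero_mul, Finset.sum_const_zero] at h1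
    exact (mul_eq_zero.1 h1.symm).resolve_right (by exact_mod_cast (Nat.factorial_pos n).ne')
  -- Both the characters and the points on which they live are indexed by partitions of `n`, so
  -- independence already implies spanning.
  have hspan := hli.span_eq_top_of_card_eq_finrank' (by
    rw [Module.finrank_fintype_fun_eq_card, Fintype.card_fin])
  have hmem : (Pi.single (1 : Equiv.Perm (Fin n)).partition (1 : ℝ)) ∈
      Submodule.span ℝ (Set.range f) := hspan ▸ Submodule.mem_top
  obtain ⟨a, ha⟩ := (Submodule.mem_span_range_iff_exists_fun ℝ).1 hmem
  refine ⟨a, fun g => ?_⟩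
  have h := congrFun ha g.partition
  simp only [Finset.sum_apply, Pi.smul_apply, smul_eq_mul, hf, Pi.single_apply] at h
  rw [h]
  congr 1
  rw [← Equiv.Perm.partition_eq_of_isConj, isConj_comm, isConj_one_right]

/-- The matrix elements span the functions on the symmetric group. -/
theorem exists_sum_D_eq_delta (h : Equiv.Perm (Fin n)) :
    ∃ a : ∀ R : Nat.Partition n, Fin (dimS R) → Fin (dimS R) → ℝ,
      ∀ g, ∑ R, ∑ i, ∑ j, a R i j * B.D R g i j = if g = h then 1 else 0 := by
  obtain ⟨a, ha⟩ := B.exists_sum_chi_eq_delta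
  refine ⟨fun R i j => a R * B.D R h i j, fun g => ?_⟩
  have h1 := ha (h⁻¹ * g)
  simp only [inv_mul_eq_one, eq_comm (a := h)] at h1
  rw [← h1]
  refine Finset.sum_congr rfl fun R _ => ?_
  rw [chi, Finset.mul_sum, Finset.sum_comm]
  refine Finset.sum_congr rfl fun i _ => ?_
  rw [B.D_mul_apply, Finset.mul_sum]
  refine Finset.sum_congr rfl fun j _ => ?_
  rw [B.D_inv_apply, mul_assoc]

end OrthogonalForm

end

section

/-! ### Matrix elements and invariant vectors of triple tensor products -/

theorem sum_prod_mul_mul {α β γ : Type*} [Fintype α] [Fintype β] [Fintype γ]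
    (f : α → ℝ) (g : β → ℝ) (h : γ → ℝ) :
    ∑ x : α × β × γ, f x.1 * g x.2.1 * h x.2.2 = (∑ a, f a) * (∑ b, g b) * ∑ c, h c := by
  simp_rw [Fintype.sum_prod_type, mul_assoc, ← Finset.mul_sum, ← Finset.sum_mul]

variable {n : ℕ}

/-- Indices of the components of `V_R ⊗ V_S ⊗ V_T`. -/
abbrev Idx3 (p : Triple n) : Type := Fin (dimS p.1) × Fin (dimS p.2.1) × Fin (dimS p.2.2)

/-- The matrix elements of `V_R ⊗ V_S ⊗ V_T`. -/
def OrthogonalForm.D3 (B : OrthogonalForm n) (p : Triple n) (σ : Perm3 n) (i j : Idx3 p) : ℝ :=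
  B.D p.1 σ.1 i.1 j.1 * B.D p.2.1 σ.2.1 i.2.1 j.2.1 * B.D p.2.2 σ.2.2 i.2.2 j.2.2

namespace OrthogonalForm

variable (B : OrthogonalForm n)

theorem D3_mul (p : Triple n) (σ ρ : Perm3 n) (i j : Idx3 p) :
    B.D3 p (σ * ρ) i j = ∑ k, B.D3 p σ i k * B.D3 p ρ k j := by
  simp only [D3, Prod.fst_mul, Prod.snd_mul, D_mul_apply]
  rw [← sum_prod_mul_mul]
  exact Finset.sum_congr rfl fun k _ => by ring

theorem D3_inv (p : Triple n) (σ : Perm3 n) (i j : Idx3 p) :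
    B.D3 p σ⁻¹ i j = B.D3 p σ j i := by
  simp only [D3, Prod.fst_inv, Prod.snd_inv, D_inv_apply]

theorem kappa_ne_zero (B : OrthogonalForm n) (p : Triple n) : kappa p ≠ 0 := by
  have h1 := dimS_pos B p.1
  have h2 := dimS_pos B p.2.1
  have h3 := dimS_pos B p.2.2
  unfold kappa
  positivity

theorem sum_D3_mul_D3 (p : Triple n) (i j k l : Idx3 p) :
    ∑ σ, B.D3 p σ i j * B.D3 p σ k l = if i = k ∧ j = l then (kappa p)⁻¹ else 0 := by
  have h : ∀ σ : Perm3 n, B.D3 p σ i j * B.D3 p σ k l =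
      (B.D p.1 σ.1 i.1 j.1 * B.D p.1 σ.1 k.1 l.1) *
      (B.D p.2.1 σ.2.1 i.2.1 j.2.1 * B.D p.2.1 σ.2.1 k.2.1 l.2.1) *
      (B.D p.2.2 σ.2.2 i.2.2 j.2.2 * B.D p.2.2 σ.2.2 k.2.2 l.2.2) := fun σ => by
    simp only [D3]
    ring
  simp_rw [h]
  rw [sum_prod_mul_mul (fun g => B.D p.1 g i.1 j.1 * B.D p.1 g k.1 l.1)
    (fun g => B.D p.2.1 g i.2.1 j.2.1 * B.D p.2.1 g k.2.1 l.2.1)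
    (fun g => B.D p.2.2 g i.2.2 j.2.2 * B.D p.2.2 g k.2.2 l.2.2),
    sum_D_mul_D, sum_D_mul_D, sum_D_mul_D]
  by_cases h : i = k ∧ j = l
  · obtain ⟨rfl, rfl⟩ := h
    simp only [and_self, if_true, kappa, inv_div]
    field_simp
  · rw [if_neg h]
    simp only [Prod.ext_iff] at h
    by_cases h1 : i.1 = k.1 ∧ j.1 = l.1
    · by_cases h2 : i.2.1 = k.2.1 ∧ j.2.1 = l.2.1
      · rw [if_neg (c := i.2.2 = k.2.2 ∧ j.2.2 = l.2.2) (by tauto), mul_zero]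
      · rw [if_neg h2, mul_zero, zero_mul]
    · rw [if_neg h1, zero_mul, zero_mul]

theorem sum_D3_mul_D3_of_ne {p q : Triple n} (hpq : p ≠ q) (i j : Idx3 p) (k l : Idx3 q) :
    ∑ σ, B.D3 p σ i j * B.D3 q σ k l = 0 := by
  have h : ∀ σ : Perm3 n, B.D3 p σ i j * B.D3 q σ k l =
      (B.D p.1 σ.1 i.1 j.1 * B.D q.1 σ.1 k.1 l.1) *
      (B.D p.2.1 σ.2.1 i.2.1 j.2.1 * B.D q.2.1 σ.2.1 k.2.1 l.2.1) *
      (B.D p.2.2 σ.2.2 i.2.2 j.2.2 * B.D q.2.2 σ.2.2 k.2.2 l.2.2) := fun σ => by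
    simp only [D3]
    ring
  simp_rw [h]
  rw [sum_prod_mul_mul (fun g => B.D p.1 g i.1 j.1 * B.D q.1 g k.1 l.1)
    (fun g => B.D p.2.1 g i.2.1 j.2.1 * B.D q.2.1 g k.2.1 l.2.1)
    (fun g => B.D p.2.2 g i.2.2 j.2.2 * B.D q.2.2 g k.2.2 l.2.2)]
  by_cases h1 : p.1 = q.1
  · by_cases h2 : p.2.1 = q.2.1
    · by_cases h3 : p.2.2 = q.2.2
      · exact absurd (Prod.ext h1 (Prod.ext h2 h3)) hpq
      · rw [B.sum_D_mul_D_of_ne h3, mul_zero]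
    · rw [B.sum_D_mul_D_of_ne h2, mul_zero, zero_mul]
  · rw [B.sum_D_mul_D_of_ne h1, zero_mul, zero_mul]

theorem exists_sum_D3_eq_delta (h : Perm3 n) :
    ∃ a : ∀ p : Triple n, Idx3 p → Idx3 p → ℝ,
      ∀ g, ∑ p, ∑ i, ∑ j, a p i j * B.D3 p g i j = if g = h then 1 else 0 := by
  obtain ⟨a, ha⟩ := B.exists_sum_D_eq_delta h.1
  obtain ⟨b, hb⟩ := B.exists_sum_D_eq_delta h.2.1
  obtain ⟨c, hc⟩ := B.exists_sum_D_eq_delta h.2.2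
  refine ⟨fun p i j => a p.1 i.1 j.1 * b p.2.1 i.2.1 j.2.1 * c p.2.2 i.2.2 j.2.2, fun g => ?_⟩
  have h1 : ∀ (p : Triple n) (i j : Idx3 p),
      a p.1 i.1 j.1 * b p.2.1 i.2.1 j.2.1 * c p.2.2 i.2.2 j.2.2 * B.D3 p g i j =
      (a p.1 i.1 j.1 * B.D p.1 g.1 i.1 j.1) * (b p.2.1 i.2.1 j.2.1 * B.D p.2.1 g.2.1 i.2.1 j.2.1) *
        (c p.2.2 i.2.2 j.2.2 * B.D p.2.2 g.2.2 i.2.2 j.2.2) := fun p i j => by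
    simp only [D3]
    ring
  have h2 : ∀ (p : Triple n), ∑ i, ∑ j,
      a p.1 i.1 j.1 * b p.2.1 i.2.1 j.2.1 * c p.2.2 i.2.2 j.2.2 * B.D3 p g i j =
      (∑ i, ∑ j, a p.1 i j * B.D p.1 g.1 i j) * (∑ i, ∑ j, b p.2.1 i j * B.D p.2.1 g.2.1 i j) *
        ∑ i, ∑ j, c p.2.2 i j * B.D p.2.2 g.2.2 i j := fun p => by
    rw [← sum_prod_mul_mul]
    refine Finset.sum_congr rfl fun i _ => ?_
    rw [← sum_prod_mul_mul]
    exact Finset.sum_congr rfl fun j _ => h1 p i j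
  simp_rw [h2]
  rw [sum_prod_mul_mul (fun R => ∑ i, ∑ j, a R i j * B.D R g.1 i j)
    (fun R => ∑ i, ∑ j, b R i j * B.D R g.2.1 i j)
    (fun R => ∑ i, ∑ j, c R i j * B.D R g.2.2 i j), ha, hb, hc]
  clear h1 h2 ha hb hc
  by_cases e1 : g.1 = h.1 <;> by_cases e2 : g.2.1 = h.2.1 <;> by_cases e3 : g.2.2 = h.2.2 <;>
    simp [Prod.ext_iff, e1, e2, e3]

end OrthogonalForm

namespace ClebschGordan

variable {B : OrthogonalForm n} (C : ClebschGordan B)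

/-- The invariant vector of `V_R ⊗ V_S ⊗ V_T` given by the Clebsch-Gordan coefficients. -/
def vec (p : Triple n) (τ : Mult p) (i : Idx3 p) : ℝ := C.coeff p.1 p.2.1 p.2.2 τ i.1 i.2.1 i.2.2

theorem sum_state_mul_state (R S : Nat.Partition n)
    (x y : Σ T : Nat.Partition n, Fin (kron R S T) × Fin (dimS T)) :
    ∑ i₁, ∑ i₂, C.state R S x (i₁, i₂) * C.state R S y (i₁, i₂) = if x = y then 1 else 0 := by
  classical
  have h := orthonormal_iff_ite.1 (C.state R S).orthonormal x y
  rw [PiLp.inner_apply, Fintype.sum_prod_type] at h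
  simp only [RCLike.inner_apply, conj_trivial] at h
  simp_rw [mul_comm (C.state R S x _)]
  convert h

theorem sum_state_complete (R S : Nat.Partition n) (i j : Fin (dimS R) × Fin (dimS S)) :
    ∑ x, C.state R S x i * C.state R S x j = if i = j then 1 else 0 := by
  have h := (C.state R S).sum_inner_mul_inner (EuclideanSpace.single i (1 : ℝ))
    (EuclideanSpace.single j (1 : ℝ))
  simp only [EuclideanSpace.inner_single_left, EuclideanSpace.inner_single_right, conj_trivial,
    one_mul, PiLp.single_apply] at h
  rw [h]
  simp only [eq_comm]

/-- This is the Clebsch-Gordan series: completeness of the coupled basis is inserted next to the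
matrix of `σ` on `V_R ⊗ V_S`, and equivariance moves `σ` onto the `T` factor. -/
theorem D_mul_D (R S : Nat.Partition n) (σ : Equiv.Perm (Fin n)) (i₁ j₁ : Fin (dimS R))
    (i₂ j₂ : Fin (dimS S)) :
    B.D R σ i₁ j₁ * B.D S σ i₂ j₂ = ∑ T, ∑ τ : Fin (kron R S T), ∑ k, ∑ l,
      C.state R S ⟨T, τ, l⟩ (i₁, i₂) * C.state R S ⟨T, τ, k⟩ (j₁, j₂) * B.D T σ l k := by
  calc B.D R σ i₁ j₁ * B.D S σ i₂ j₂
      = ∑ k₁, ∑ k₂, B.D R σ i₁ k₁ * B.D S σ i₂ k₂ *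
          ∑ x, C.state R S x (k₁, k₂) * C.state R S x (j₁, j₂) := by
        simp_rw [sum_state_complete, Prod.mk.injEq, ite_and]
        simp
    _ = ∑ x, (∑ k₁, ∑ k₂, B.D R σ i₁ k₁ * B.D S σ i₂ k₂ * C.state R S x (k₁, k₂)) *
          C.state R S x (j₁, j₂) := by
        simp_rw [Finset.mul_sum, Finset.sum_mul]
        refine (Finset.sum_congr rfl fun _ _ => Finset.sum_comm).trans (Finset.sum_comm.trans ?_)
        simp_rw [mul_assoc]
    _ = _ := by
        rw [Fintype.sum_sigma]
        refine Finset.sum_congr rfl fun T _ => ?_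
        rw [Fintype.sum_prod_type]
        refine Finset.sum_congr rfl fun τ _ => Finset.sum_congr rfl fun k _ => ?_
        rw [C.equivariant, Finset.sum_mul]
        exact Finset.sum_congr rfl fun l _ => by ring

/-- The invariant vectors span the image of the average over the diagonal subgroup. -/
theorem sum_D3_diag (p : Triple n) (i j : Idx3 p) :
    ∑ γ : Equiv.Perm (Fin n), B.D3 p (diag γ) i j =
      (n ! : ℝ) / dimS p.2.2 * ∑ τ, C.vec p τ i * C.vec p τ j := by
  obtain ⟨R, S, T⟩ := p
  obtain ⟨i₁, i₂, i₃⟩ := i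
  obtain ⟨j₁, j₂, j₃⟩ := j
  have h : ∀ γ : Equiv.Perm (Fin n), B.D3 (R, S, T) (diag γ) (i₁, i₂, i₃) (j₁, j₂, j₃) =
      ∑ T', ∑ τ : Fin (kron R S T'), ∑ k, ∑ l,
        C.state R S ⟨T', τ, l⟩ (i₁, i₂) * C.state R S ⟨T', τ, k⟩ (j₁, j₂) *
          (B.D T' γ l k * B.D T γ i₃ j₃) := fun γ => by
    have := C.D_mul_D R S γ i₁ j₁ i₂ j₂
    simp only [OrthogonalForm.D3, diag]
    rw [this]
    simp_rw [Finset.sum_mul, mul_assoc]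
  simp_rw [h]
  -- Orthogonality against `D^T(γ)` with indices `i₃, j₃` selects `T' = T`, `k = j₃` and `l = i₃`.
  rw [Finset.sum_comm, Finset.sum_eq_single T]
  · rw [Finset.sum_comm, Finset.mul_sum]
    refine Finset.sum_congr rfl fun τ _ => ?_
    rw [Finset.sum_comm, Finset.sum_eq_single j₃]
    · rw [Finset.sum_comm, Finset.sum_eq_single i₃]
      · rw [← Finset.mul_sum, B.sum_D_mul_D, if_pos ⟨rfl, rfl⟩, mul_comm]
        rfl
      · intro l _ hl
        rw [← Finset.mul_sum, B.sum_D_mul_D, if_neg (by tauto), mul_zero]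
      · simp
    · intro k _ hk
      rw [Finset.sum_comm]
      refine Finset.sum_eq_zero fun l _ => ?_
      rw [← Finset.mul_sum, B.sum_D_mul_D, if_neg (by tauto), mul_zero]
    · simp
  · intro T' _ hT
    rw [Finset.sum_comm]
    refine Finset.sum_eq_zero fun τ _ => ?_
    rw [Finset.sum_comm]
    refine Finset.sum_eq_zero fun k _ => ?_
    rw [Finset.sum_comm]
    refine Finset.sum_eq_zero fun l _ => ?_
    rw [← Finset.mul_sum, B.sum_D_mul_D_of_ne hT, mul_zero]
  · simp

/-- For fixed `i₃` the coefficients form a unit vector, and `i₃` takes `d(T)` values. Both factors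
`d(T)` in the theorem originate here. -/
theorem sum_vec_mul_vec (p : Triple n) (τ τ' : Mult p) :
    ∑ i, C.vec p τ i * C.vec p τ' i = if τ = τ' then (dimS p.2.2 : ℝ) else 0 := by
  simp only [vec, coeff, Fintype.sum_prod_type]
  simp_rw [Finset.sum_comm (s := (Finset.univ : Finset (Fin (dimS p.2.1))))
    (t := (Finset.univ : Finset (Fin (dimS p.2.2))))]
  rw [Finset.sum_comm]
  simp_rw [sum_state_mul_state]
  simp

/-- By `sum_D3_diag` the vector is an eigenvector, with eigenvalue `n!`, of the sum over the
diagonal subgroup, and that sum absorbs every further diagonal element. -/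
theorem sum_vec_mul_D3_diag (p : Triple n) (τ : Mult p) (γ : Equiv.Perm (Fin n)) (j : Idx3 p) :
    ∑ i, C.vec p τ i * B.D3 p (diag γ) i j = C.vec p τ j := by
  have hd : (dimS p.2.2 : ℝ) ≠ 0 := by exact_mod_cast (dimS_pos B p.2.2).ne'
  have hn : (n ! : ℝ) ≠ 0 := by exact_mod_cast (Nat.factorial_pos n).ne'
  have h1 : ∀ j, ∑ i, C.vec p τ i * ∑ γ, B.D3 p (diag γ) i j = n ! * C.vec p τ j := by
    intro j
    simp_rw [C.sum_D3_diag, Finset.mul_sum]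
    rw [Finset.sum_comm]
    have : ∀ τ' : Mult p, ∑ i, C.vec p τ i * ((n ! : ℝ) / dimS p.2.2 *
        (C.vec p τ' i * C.vec p τ' j)) =
        (n ! : ℝ) / dimS p.2.2 * C.vec p τ' j * ∑ i, C.vec p τ i * C.vec p τ' i := fun τ' => by
      rw [Finset.mul_sum]
      exact Finset.sum_congr rfl fun i _ => by ring
    simp_rw [this, sum_vec_mul_vec]
    simp
    field_simp
  have h2 : ∀ i j, ∑ k, (∑ γ', B.D3 p (diag γ') i k) * B.D3 p (diag γ) k j =
      ∑ γ', B.D3 p (diag γ') i j := by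
    intro i j
    simp_rw [Finset.sum_mul]
    rw [Finset.sum_comm]
    simp_rw [← B.D3_mul]
    exact Equiv.sum_comp (Equiv.mulRight γ) fun g => B.D3 p (diag g) i j
  have h3 : (n ! : ℝ) * ∑ i, C.vec p τ i * B.D3 p (diag γ) i j = n ! * C.vec p τ j := by
    rw [← h1 j]
    simp_rw [← h2 _ j, Finset.mul_sum]
    rw [Finset.sum_comm]
    refine Finset.sum_congr rfl fun i _ => ?_
    rw [← mul_assoc, ← h1, Finset.sum_mul]
    exact Finset.sum_congr rfl fun k _ => by ring
  exact mul_left_cancel₀ hn h3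

end ClebschGordan

variable {B : OrthogonalForm n} (C : ClebschGordan B)

theorem QunCoeff_eq (p : Triple n) (τ τ' : Mult p) (σ : Perm3 n) :
    QunCoeff C p τ τ' σ =
      kappa p * ∑ i, ∑ j, C.vec p τ i * C.vec p τ' j * B.D3 p σ i j := by
  simp only [QunCoeff, Fintype.sum_prod_type, ClebschGordan.vec, OrthogonalForm.D3, mul_assoc]

/-- Inversion transposes the orthogonal matrices. This turns left invariance into right invariance,
and it makes the conjugate observable in the two-point function appear with exchanged multiplicity
labels. -/
theorem QunCoeff_inv (p : Triple n) (τ τ' : Mult p) (σ : Perm3 n) :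
    QunCoeff C p τ τ' σ⁻¹ = QunCoeff C p τ' τ σ := by
  rw [QunCoeff_eq, QunCoeff_eq, Finset.sum_comm]
  simp_rw [B.D3_inv, mul_comm (C.vec p τ _)]

theorem QunCoeff_diag_mul (p : Triple n) (τ τ' : Mult p) (γ : Equiv.Perm (Fin n)) (σ : Perm3 n) :
    QunCoeff C p τ τ' (diag γ * σ) = QunCoeff C p τ τ' σ := by
  rw [QunCoeff_eq, QunCoeff_eq]
  congr 1
  simp_rw [B.D3_mul, Finset.mul_sum]
  rw [Finset.sum_comm, Finset.sum_comm (f := fun i j => C.vec p τ i * C.vec p τ' j * B.D3 p σ i j)]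
  refine Finset.sum_congr rfl fun j _ => ?_
  rw [Finset.sum_comm]
  refine Finset.sum_congr rfl fun k _ => ?_
  rw [← C.sum_vec_mul_D3_diag p τ γ k, Finset.sum_mul, Finset.sum_mul]
  exact Finset.sum_congr rfl fun i _ => by ring

theorem QunCoeff_mul_diag (p : Triple n) (τ τ' : Mult p) (γ : Equiv.Perm (Fin n)) (σ : Perm3 n) :
    QunCoeff C p τ τ' (σ * diag γ) = QunCoeff C p τ τ' σ := by
  rw [← QunCoeff_inv C p τ' τ, mul_inv_rev, show (diag γ : Perm3 n)⁻¹ = diag γ⁻¹ from rfl,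
    QunCoeff_diag_mul, QunCoeff_inv]

/-- Convolution of a matrix element with a Fourier basis element. -/
theorem sum_D3_mul_QunCoeff (p : Triple n) (τ τ' : Mult p) (i j : Idx3 p) (x : Perm3 n) :
    ∑ σ, B.D3 p σ i j * QunCoeff C p τ τ' (σ⁻¹ * x) =
      C.vec p τ j * ∑ l, C.vec p τ' l * B.D3 p x i l := by
  have h : ∀ σ, B.D3 p σ i j * QunCoeff C p τ τ' (σ⁻¹ * x) = ∑ k, ∑ l, ∑ m,
      kappa p * C.vec p τ k * C.vec p τ' l * B.D3 p x m l *
        (B.D3 p σ i j * B.D3 p σ m k) := by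
    intro σ
    rw [QunCoeff_eq, Finset.mul_sum, Finset.mul_sum]
    refine Finset.sum_congr rfl fun k _ => ?_
    rw [Finset.mul_sum, Finset.mul_sum]
    refine Finset.sum_congr rfl fun l _ => ?_
    rw [B.D3_mul, Finset.mul_sum, Finset.mul_sum, Finset.mul_sum]
    refine Finset.sum_congr rfl fun m _ => ?_
    rw [B.D3_inv]
    ring
  simp_rw [h]
  rw [Finset.sum_comm]
  have h2 : ∀ k, ∑ σ : Perm3 n, ∑ l, ∑ m, kappa p * C.vec p τ k * C.vec p τ' l * B.D3 p x m l *
        (B.D3 p σ i j * B.D3 p σ m k) =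
      if j = k then C.vec p τ k * ∑ l, C.vec p τ' l * B.D3 p x i l else 0 := by
    intro k
    rw [Finset.sum_comm]
    have : ∀ l, ∑ σ : Perm3 n, ∑ m, kappa p * C.vec p τ k * C.vec p τ' l * B.D3 p x m l *
        (B.D3 p σ i j * B.D3 p σ m k) =
        if j = k then C.vec p τ k * (C.vec p τ' l * B.D3 p x i l) else 0 := by
      intro l
      rw [Finset.sum_comm]
      simp_rw [← Finset.mul_sum, B.sum_D3_mul_D3, ite_and]
      have hk := B.kappa_ne_zero p
      simp only [mul_ite, mul_zero, Finset.sum_ite_eq, Finset.mem_univ, if_true]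
      split_ifs
      · field_simp
      · rfl
    simp_rw [this]
    split_ifs
    · rw [Finset.mul_sum]
    · simp
  simp_rw [h2]
  simp

/-- Convolving matrix elements contracts the inner vectors `vec p τ₂` and `vec p τ₃`, whose inner
product is `d(T)` or zero. -/
theorem sum_QunCoeff_mul_QunCoeff (p : Triple n) (τ₁ τ₂ τ₃ τ₄ : Mult p) (x : Perm3 n) :
    ∑ σ, QunCoeff C p τ₁ τ₂ σ * QunCoeff C p τ₃ τ₄ (σ⁻¹ * x) =
      if τ₂ = τ₃ then dimS p.2.2 * QunCoeff C p τ₁ τ₄ x else 0 := by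
  have h : ∀ σ, QunCoeff C p τ₁ τ₂ σ * QunCoeff C p τ₃ τ₄ (σ⁻¹ * x) =
      ∑ i, ∑ j, kappa p * C.vec p τ₁ i * C.vec p τ₂ j *
        (B.D3 p σ i j * QunCoeff C p τ₃ τ₄ (σ⁻¹ * x)) := by
    intro σ
    rw [QunCoeff_eq C p τ₁ τ₂, Finset.mul_sum, Finset.sum_mul]
    refine Finset.sum_congr rfl fun i _ => ?_
    rw [Finset.mul_sum, Finset.sum_mul]
    exact Finset.sum_congr rfl fun j _ => by ring
  simp_rw [h]
  rw [Finset.sum_comm]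
  have h2 : ∀ i, ∑ σ : Perm3 n, ∑ j, kappa p * C.vec p τ₁ i * C.vec p τ₂ j *
        (B.D3 p σ i j * QunCoeff C p τ₃ τ₄ (σ⁻¹ * x)) =
      kappa p * (∑ l, C.vec p τ₁ i * C.vec p τ₄ l * B.D3 p x i l) *
        ∑ j, C.vec p τ₂ j * C.vec p τ₃ j := by
    intro i
    rw [Finset.sum_comm, Finset.mul_sum]
    refine Finset.sum_congr rfl fun j _ => ?_
    rw [← Finset.mul_sum, sum_D3_mul_QunCoeff]
    simp_rw [mul_assoc (C.vec p τ₁ i), ← Finset.mul_sum]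
    ring
  simp_rw [h2, C.sum_vec_mul_vec]
  rw [← Finset.sum_mul, ← Finset.mul_sum, ← QunCoeff_eq]
  split_ifs
  · ring
  · ring

theorem sum_QunCoeff_mul_QunCoeff_of_ne {p q : Triple n} (hpq : p ≠ q) (τ₁ τ₂ : Mult p)
    (τ₃ τ₄ : Mult q) (x : Perm3 n) :
    ∑ σ, QunCoeff C p τ₁ τ₂ σ * QunCoeff C q τ₃ τ₄ (σ⁻¹ * x) = 0 := by
  have h : ∀ σ, QunCoeff C p τ₁ τ₂ σ * QunCoeff C q τ₃ τ₄ (σ⁻¹ * x) =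
      ∑ i, ∑ j, ∑ k, ∑ l, ∑ m, kappa p * C.vec p τ₁ i * C.vec p τ₂ j *
        (kappa q * C.vec q τ₃ k * C.vec q τ₄ l * B.D3 q x m l) *
        (B.D3 p σ i j * B.D3 q σ m k) := by
    intro σ
    rw [QunCoeff_eq C p τ₁ τ₂, Finset.mul_sum, Finset.sum_mul]
    refine Finset.sum_congr rfl fun i _ => ?_
    rw [Finset.mul_sum, Finset.sum_mul]
    refine Finset.sum_congr rfl fun j _ => ?_
    rw [QunCoeff_eq, Finset.mul_sum, Finset.mul_sum]
    refine Finset.sum_congr rfl fun k _ => ?_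
    rw [Finset.mul_sum, Finset.mul_sum]
    refine Finset.sum_congr rfl fun l _ => ?_
    rw [B.D3_mul, Finset.mul_sum, Finset.mul_sum, Finset.mul_sum]
    refine Finset.sum_congr rfl fun m _ => ?_
    rw [B.D3_inv]
    ring
  simp_rw [h]
  rw [Finset.sum_comm]
  refine Finset.sum_eq_zero fun i _ => ?_
  rw [Finset.sum_comm]
  refine Finset.sum_eq_zero fun j _ => ?_
  rw [Finset.sum_comm]
  refine Finset.sum_eq_zero fun k _ => ?_
  rw [Finset.sum_comm]
  refine Finset.sum_eq_zero fun l _ => ?_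
  rw [Finset.sum_comm]
  refine Finset.sum_eq_zero fun m _ => ?_
  rw [← Finset.mul_sum, B.sum_D3_mul_D3_of_ne hpq, mul_zero]

end

section

/-! ### The Fourier basis of the double coset algebra -/

variable {n : ℕ}

/-- The element of the group algebra with given coefficients. -/
def ofFun (n : ℕ) : (Perm3 n → ℂ) →ₗ[ℂ] Alg3 n where
  toFun f := ∑ σ, MonoidAlgebra.single σ (f σ)
  map_add' f g := by simp [MonoidAlgebra.single_add, Finset.sum_add_distrib]
  map_smul' c f := by simp [Finset.smul_sum, MonoidAlgebra.smul_single]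

theorem ofFun_apply (f : Perm3 n → ℂ) : ofFun n f = ∑ σ, MonoidAlgebra.single σ (f σ) := rfl

theorem ofFun_coeff (f : Perm3 n → ℂ) (σ : Perm3 n) : (ofFun n f).coeff σ = f σ := by
  classical
  simp [ofFun_apply, Finsupp.single_apply]

theorem ofFun_mul (f g : Perm3 n → ℂ) :
    ofFun n f * ofFun n g = ofFun n fun x => ∑ σ, f σ * g (σ⁻¹ * x) := by
  simp_rw [ofFun_apply, Finset.sum_mul_sum, MonoidAlgebra.single_mul_single]
  have h : ∀ x, MonoidAlgebra.single x (∑ σ, f σ * g (σ⁻¹ * x)) =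
      ∑ σ : Perm3 n, MonoidAlgebra.single x (f σ * g (σ⁻¹ * x)) := fun x =>
    map_sum (MonoidAlgebra.singleAddHom x) _ _
  simp_rw [h]
  rw [Finset.sum_comm (f := fun x σ => MonoidAlgebra.single x (f σ * g (σ⁻¹ * x)))]
  refine Finset.sum_congr rfl fun σ _ => ?_
  rw [← Equiv.sum_comp (Equiv.mulLeft σ)
    fun x => MonoidAlgebra.single x (f σ * g (σ⁻¹ * x))]
  simp

theorem single_mul_ofFun_mul_single (a b : Perm3 n) (f : Perm3 n → ℂ) :
    MonoidAlgebra.single a (1 : ℂ) * ofFun n f * MonoidAlgebra.single b 1 =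
      ofFun n fun x => f (a⁻¹ * x * b⁻¹) := by
  simp_rw [ofFun_apply, Finset.mul_sum, Finset.sum_mul, MonoidAlgebra.single_mul_single]
  rw [← Equiv.sum_comp ((Equiv.mulLeft a).trans (Equiv.mulRight b))
    fun x => MonoidAlgebra.single x (f (a⁻¹ * x * b⁻¹))]
  simp [mul_assoc]

theorem diag_inv (γ : Equiv.Perm (Fin n)) : diag γ⁻¹ = (diag γ)⁻¹ := rfl

/-- The sum of all two-sided translates of an element by the diagonal subgroup. -/
def doubleCosetSum (n : ℕ) : Alg3 n →ₗ[ℂ] Alg3 n :=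
  ∑ γ₁ : Equiv.Perm (Fin n), ∑ γ₂ : Equiv.Perm (Fin n),
    LinearMap.mulLeftRight ℂ
      (MonoidAlgebra.single (diag γ₁) (1 : ℂ), MonoidAlgebra.single (diag γ₂) 1)

theorem doubleCosetSum_apply (x : Alg3 n) :
    doubleCosetSum n x = ∑ γ₁ : Equiv.Perm (Fin n), ∑ γ₂ : Equiv.Perm (Fin n),
      MonoidAlgebra.single (diag γ₁) (1 : ℂ) * x * MonoidAlgebra.single (diag γ₂) 1 := by
  simp [doubleCosetSum]

theorem doubleCosetSpace_eq : doubleCosetSpace n = LinearMap.range (doubleCosetSum n) := by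
  have htop : Submodule.span ℂ (Set.range fun σ : Perm3 n => MonoidAlgebra.single σ (1 : ℂ)) = ⊤ := by
    refine Submodule.eq_top_iff'.2 fun x => ?_
    induction x using MonoidAlgebra.induction_linear with
    | zero => exact Submodule.zero_mem _
    | add f g hf hg => exact Submodule.add_mem _ hf hg
    | single σ c =>
      have : MonoidAlgebra.single σ c = c • MonoidAlgebra.single σ (1 : ℂ) := by simp
      rw [this]
      exact Submodule.smul_mem _ _ (Submodule.subset_span ⟨σ, rfl⟩)
  rw [LinearMap.range_eq_map, ← htop, Submodule.map_span, ← Set.range_comp, doubleCosetSpace]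
  congr 2
  funext σ
  simp [doubleCosetSum_apply, MonoidAlgebra.single_mul_single]

variable {B : OrthogonalForm n} (C : ClebschGordan B)

theorem Qun_eq_ofFun (p : Triple n) (τ τ' : Mult p) :
    Qun C p τ τ' = ofFun n fun σ => (QunCoeff C p τ τ' σ : ℂ) := rfl

/-- Two-sided invariance makes all `(n!)²` translates equal. As this eigenvalue is nonzero, the
element lies in the range of the averaging map. -/
theorem doubleCosetSum_Qun (p : Triple n) (τ τ' : Mult p) :
    doubleCosetSum n (Qun C p τ τ') = ((n ! : ℂ) * n !) • Qun C p τ τ' := by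
  have h : ∀ γ₁ γ₂ : Equiv.Perm (Fin n), MonoidAlgebra.single (diag γ₁) (1 : ℂ) * Qun C p τ τ' *
      MonoidAlgebra.single (diag γ₂) 1 = Qun C p τ τ' := by
    intro γ₁ γ₂
    rw [Qun_eq_ofFun, single_mul_ofFun_mul_single]
    refine congrArg (ofFun n) (funext fun x => ?_)
    rw [← diag_inv, ← diag_inv, QunCoeff_mul_diag, QunCoeff_diag_mul]
  rw [doubleCosetSum_apply, Finset.sum_congr rfl fun _ _ => Finset.sum_congr rfl fun _ _ => h _ _]
  simp only [Finset.sum_const, Finset.card_univ, Fintype.card_perm, Fintype.card_fin, mul_smul,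
    ← Nat.cast_smul_eq_nsmul ℂ]

theorem Qun_mul_Qun (p : Triple n) (τ₁ τ₂ τ₃ τ₄ : Mult p) :
    Qun C p τ₁ τ₂ * Qun C p τ₃ τ₄ =
      if τ₂ = τ₃ then (dimS p.2.2 : ℂ) • Qun C p τ₁ τ₄ else 0 := by
  rw [Qun_eq_ofFun, Qun_eq_ofFun, Qun_eq_ofFun, ofFun_mul]
  have h : (fun x => ∑ σ, (QunCoeff C p τ₁ τ₂ σ : ℂ) * (QunCoeff C p τ₃ τ₄ (σ⁻¹ * x) : ℂ)) =
      if τ₂ = τ₃ then (dimS p.2.2 : ℂ) • fun σ => (QunCoeff C p τ₁ τ₄ σ : ℂ) else 0 := by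
    funext x
    have := congrArg (fun r : ℝ => (r : ℂ)) (sum_QunCoeff_mul_QunCoeff C p τ₁ τ₂ τ₃ τ₄ x)
    push_cast at this
    rw [this]
    split_ifs <;> simp
  rw [h]
  split_ifs
  · rw [map_smul]
  · rw [map_zero]

theorem Qun_mul_Qun_of_ne {p q : Triple n} (hpq : p ≠ q) (τ₁ τ₂ : Mult p) (τ₃ τ₄ : Mult q) :
    Qun C p τ₁ τ₂ * Qun C q τ₃ τ₄ = 0 := by
  rw [Qun_eq_ofFun, Qun_eq_ofFun, ofFun_mul, ← map_zero (ofFun n)]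
  refine congrArg (ofFun n) (funext fun x => ?_)
  rw [Pi.zero_apply]
  exact_mod_cast sum_QunCoeff_mul_QunCoeff_of_ne C hpq τ₁ τ₂ τ₃ τ₄ x

theorem QunCoeff_one (p : Triple n) (τ τ' : Mult p) :
    QunCoeff C p τ τ' 1 = if τ = τ' then kappa p * dimS p.2.2 else 0 := by
  have h : ∀ i j : Idx3 p, B.D3 p 1 i j = if i = j then 1 else 0 := by
    rintro ⟨i, j, k⟩ ⟨i', j', k'⟩
    simp [OrthogonalForm.D3, OrthogonalForm.D_one, Matrix.one_apply, ← ite_and]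
    congr 1
    simp only [eq_iff_iff]
    tauto
  simp_rw [QunCoeff_eq, h]
  simp [C.sum_vec_mul_vec]

/-- Multiplying a relation by the diagonal elements labelled `τ, τ` on the left and `τ', τ'` on the
right isolates a single coefficient, as with matrix units. -/
theorem linearIndependent_Qun :
    LinearIndependent ℂ fun a : Label n => Qun C a.1 a.2.1 a.2.2 := by
  classical
  rw [Fintype.linearIndependent_iff]
  rintro c hc ⟨p, τ, τ'⟩
  have h1 := congrArg (fun x => (Qun C p τ τ * x * Qun C p τ' τ').coeff) hc
  have hd : (dimS p.2.2 : ℂ) ≠ 0 := by exact_mod_cast (dimS_pos B p.2.2).ne'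
  have h2 : Qun C p τ τ * (∑ a : Label n, c a • Qun C a.1 a.2.1 a.2.2) * Qun C p τ' τ' =
      (c ⟨p, τ, τ'⟩ * (dimS p.2.2 * dimS p.2.2)) • Qun C p τ τ' := by
    rw [Finset.mul_sum, Finset.sum_mul, Finset.sum_eq_single ⟨p, τ, τ'⟩]
    · rw [mul_smul_comm, smul_mul_assoc, Qun_mul_Qun, if_pos rfl, smul_mul_assoc, Qun_mul_Qun,
        if_pos rfl, smul_smul, smul_smul, mul_assoc]
    · rintro ⟨q, τ₃, τ₄⟩ _ hne
      by_cases hpq : p = q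
      · subst hpq
        by_cases h3 : τ = τ₃
        · by_cases h4 : τ₄ = τ'
          · subst h3 h4
            exact absurd rfl hne
          · simp [Qun_mul_Qun, h3, h4]
        · simp [Qun_mul_Qun, h3]
      · simp [Qun_mul_Qun_of_ne C hpq]
    · simp
  -- If it vanished, so would its product with the element labelled `τ', τ`, which is `d(T)` times a
  -- diagonal element; but diagonal elements have coefficient `kappa p * d(T)` at the identity.
  have h3 : Qun C p τ τ' ≠ 0 := by
    intro h0
    have h4 := Qun_mul_Qun C p τ τ' τ' τ
    rw [h0, zero_mul, if_pos rfl] at h4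
    have h5 := congrArg (fun x => x.coeff 1) h4
    simp only [MonoidAlgebra.coeff_zero, MonoidAlgebra.coeff_smul, Finsupp.coe_zero, Pi.zero_apply,
      Finsupp.coe_smul, Pi.smul_apply, Qun_eq_ofFun, ofFun_coeff, QunCoeff_one, if_true] at h5
    have hk : (kappa p : ℂ) ≠ 0 := by exact_mod_cast B.kappa_ne_zero p
    simp [hk, hd] at h5
  have h4 : (c ⟨p, τ, τ'⟩ * (dimS p.2.2 * dimS p.2.2)) • Qun C p τ τ' = 0 := by
    rw [← h2, hc]
    simp
  exact (mul_eq_zero.1 ((smul_eq_zero.1 h4).resolve_right h3)).resolve_right (mul_ne_zero hd hd)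

/-- Averaging a matrix element over the diagonal subgroup on both sides. -/
theorem sum_sum_D3 (p : Triple n) (i j : Idx3 p) (x : Perm3 n) :
    ∑ γ₁ : Equiv.Perm (Fin n), ∑ γ₂ : Equiv.Perm (Fin n),
        B.D3 p ((diag γ₁)⁻¹ * x * (diag γ₂)⁻¹) i j =
      ∑ τ, ∑ τ', ((n ! : ℝ) / dimS p.2.2) ^ 2 * C.vec p τ i * C.vec p τ' j * (kappa p)⁻¹ *
        QunCoeff C p τ τ' x := by
  have hk := B.kappa_ne_zero p
  calc ∑ γ₁ : Equiv.Perm (Fin n), ∑ γ₂ : Equiv.Perm (Fin n),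
        B.D3 p ((diag γ₁)⁻¹ * x * (diag γ₂)⁻¹) i j
      = ∑ γ₁ : Equiv.Perm (Fin n), ∑ γ₂ : Equiv.Perm (Fin n),
        B.D3 p (diag γ₁ * x * diag γ₂) i j := by
        rw [← Equiv.sum_comp (Equiv.inv _)]
        refine Finset.sum_congr rfl fun γ₁ _ => ?_
        rw [← Equiv.sum_comp (Equiv.inv _)]
        refine Finset.sum_congr rfl fun γ₂ _ => ?_
        rfl
    _ = ∑ l, ∑ k, (∑ γ₁ : Equiv.Perm (Fin n), B.D3 p (diag γ₁) i k) * B.D3 p x k l *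
          ∑ γ₂ : Equiv.Perm (Fin n), B.D3 p (diag γ₂) l j := by
        simp_rw [B.D3_mul, Finset.sum_mul, Finset.mul_sum]
        rw [Finset.sum_congr rfl fun _ _ => Finset.sum_comm, Finset.sum_comm]
        refine Finset.sum_congr rfl fun l _ => ?_
        rw [Finset.sum_congr rfl fun _ _ => Finset.sum_comm, Finset.sum_comm]
    _ = _ := by
        simp_rw [C.sum_D3_diag, QunCoeff_eq, Finset.mul_sum, Finset.sum_mul]
        rw [Finset.sum_comm]
        have hcomm : ∀ F : Idx3 p → Idx3 p → Mult p → Mult p → ℝ,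
            ∑ k, ∑ l, ∑ τ', ∑ τ, F k l τ τ' = ∑ τ, ∑ τ', ∑ k, ∑ l, F k l τ τ' := by
          intro F
          rw [Finset.sum_congr rfl fun _ _ => Finset.sum_congr rfl fun _ _ => Finset.sum_comm,
            Finset.sum_congr rfl fun _ _ => Finset.sum_comm, Finset.sum_comm]
          refine Finset.sum_congr rfl fun τ _ => ?_
          rw [Finset.sum_congr rfl fun _ _ => Finset.sum_comm, Finset.sum_comm]
        rw [hcomm]
        refine Finset.sum_congr rfl fun τ _ => Finset.sum_congr rfl fun τ' _ =>
          Finset.sum_congr rfl fun k _ => Finset.sum_congr rfl fun l _ => ?_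
        field_simp

/-- For the harder inclusion, a point mass is expanded in matrix elements by completeness, and the
two-sided average of each matrix element is a combination of the `Qun` by `sum_sum_D3`. -/
theorem span_Qun :
    Submodule.span ℂ (Set.range fun a : Label n => Qun C a.1 a.2.1 a.2.2) =
      doubleCosetSpace n := by
  have hn : ((n ! : ℂ) * n !) ≠ 0 :=
    mul_ne_zero (by exact_mod_cast (Nat.factorial_pos n).ne')
      (by exact_mod_cast (Nat.factorial_pos n).ne')
  apply le_antisymm
  · rw [Submodule.span_le, doubleCosetSpace_eq]
    rintro _ ⟨a, rfl⟩
    rw [SetLike.mem_coe, ← Submodule.smul_mem_iff _ hn, ← doubleCosetSum_Qun]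
    exact LinearMap.mem_range_self _ _
  · rw [doubleCosetSpace_eq]
    have hE : ∀ (p : Triple n) (i j : Idx3 p),
        doubleCosetSum n (ofFun n fun σ => (B.D3 p σ i j : ℂ)) ∈
          Submodule.span ℂ (Set.range fun a : Label n => Qun C a.1 a.2.1 a.2.2) := by
      intro p i j
      have h : doubleCosetSum n (ofFun n fun σ => (B.D3 p σ i j : ℂ)) =
          ∑ τ, ∑ τ', ((((n ! : ℝ) / dimS p.2.2) ^ 2 * C.vec p τ i * C.vec p τ' j *
            (kappa p)⁻¹ : ℝ) : ℂ) • Qun C p τ τ' := by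
        rw [doubleCosetSum_apply]
        simp_rw [single_mul_ofFun_mul_single, Qun_eq_ofFun, ← map_smul, ← map_sum]
        congr 1
        funext x
        simp only [Finset.sum_apply, Pi.smul_apply, smul_eq_mul]
        exact_mod_cast sum_sum_D3 C p i j x
      rw [h]
      exact Submodule.sum_mem _ fun τ _ => Submodule.sum_mem _ fun τ' _ =>
        Submodule.smul_mem _ _ (Submodule.subset_span ⟨⟨p, τ, τ'⟩, rfl⟩)
    rw [doubleCosetSpace_eq.symm, doubleCosetSpace, Submodule.span_le]
    rintro _ ⟨h, rfl⟩
    obtain ⟨a, ha⟩ := B.exists_sum_D3_eq_delta h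
    have h1 : MonoidAlgebra.single h (1 : ℂ) =
        ∑ p, ∑ i, ∑ j, (a p i j : ℂ) • ofFun n fun σ => (B.D3 p σ i j : ℂ) := by
      simp_rw [← map_smul, ← map_sum]
      apply MonoidAlgebra.coeff_injective
      ext g
      rw [ofFun_coeff]
      simp only [Finset.sum_apply, Pi.smul_apply, smul_eq_mul, MonoidAlgebra.coeff_single]
      rw [Finsupp.single_apply]
      have := congrArg (fun r : ℝ => (r : ℂ)) (ha g)
      push_cast at this
      rw [this]
      by_cases hg : g = h
      · simp [hg]
      · rw [if_neg (Ne.symm hg), if_neg hg, Complex.ofReal_zero]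
    have h2 : ∑ γ₁ : Equiv.Perm (Fin n), ∑ γ₂ : Equiv.Perm (Fin n),
        MonoidAlgebra.single (diag γ₁ * h * diag γ₂) (1 : ℂ) =
        doubleCosetSum n (MonoidAlgebra.single h 1) := by
      simp [doubleCosetSum_apply, MonoidAlgebra.single_mul_single]
    simp only [SetLike.mem_coe]
    rw [h2, h1]
    simp_rw [map_sum, map_smul]
    exact Submodule.sum_mem _ fun p _ => Submodule.sum_mem _ fun i _ => Submodule.sum_mem _
      fun j _ => Submodule.smul_mem _ _ (hE p i j)

/-! ### The span of the observables -/

theorem observable_single (N : ℕ) (σ : Perm3 n) (c : ℂ) :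
    observable N (MonoidAlgebra.single σ c) = c • permObservable N σ := by
  simp [observable]

theorem observable_ofFun (N : ℕ) (f : Perm3 n → ℂ) :
    observable N (ofFun n f) = ∑ σ, f σ • permObservable N σ := by
  simp [ofFun_apply, observable_single]

/-- `γ₁` is removed by relabelling the copies of `Φ`, and `γ₂` by reordering the commuting factors
`Φ̄`. -/
theorem permObservable_diag_mul_diag (N : ℕ) (γ₁ γ₂ : Equiv.Perm (Fin n)) (σ : Perm3 n) :
    permObservable N (diag γ₁ * σ * diag γ₂) = permObservable N σ := by
  unfold permObservable
  rw [← Equiv.sum_comp (Equiv.arrowCongr γ₁ (Equiv.refl (Idx N)))]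
  refine Finset.sum_congr rfl fun x _ => ?_
  congr 1
  · rw [← Equiv.prod_comp γ₁]
    simp
  · rw [← Equiv.prod_comp γ₂ fun a => (MvPolynomial.X (Sum.inr
      ((x (σ.1 a)).1, (x (σ.2.1 a)).2.1, (x (σ.2.2 a)).2.2)) : TensorPoly N)]
    simp [diag]

/-- By invariance a double coset sum is sent to `(n!)²` times the observable of its representative,
so `𝒦(n)` has the same image as the whole group algebra. -/
theorem span_fourierObservable (N : ℕ) :
    Submodule.span ℂ (Set.range (fourierObservable C N)) =
      Submodule.span ℂ (Set.range (permObservable N : Perm3 n → _)) := by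
  have h1 : Set.range (fourierObservable C N) =
      observable N '' Set.range fun a : Label n => Qun C a.1 a.2.1 a.2.2 := by
    rw [← Set.range_comp]
    rfl
  have hn : ((n ! : ℂ) * n !) ≠ 0 :=
    mul_ne_zero (by exact_mod_cast (Nat.factorial_pos n).ne')
      (by exact_mod_cast (Nat.factorial_pos n).ne')
  rw [h1, ← Submodule.map_span, span_Qun, doubleCosetSpace, Submodule.map_span, ← Set.range_comp]
  have h2 : (observable N ∘ fun σ : Perm3 n => ∑ γ₁ : Equiv.Perm (Fin n),
      ∑ γ₂ : Equiv.Perm (Fin n), MonoidAlgebra.single (diag γ₁ * σ * diag γ₂) (1 : ℂ)) =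
      fun σ => ((n ! : ℂ) * n !) • permObservable N σ := by
    funext σ
    simp [observable_single, permObservable_diag_mul_diag, Fintype.card_perm, mul_smul,
      ← Nat.cast_smul_eq_nsmul ℂ]
  rw [h2]
  apply le_antisymm
  · rw [Submodule.span_le]
    rintro _ ⟨σ, rfl⟩
    exact Submodule.smul_mem _ _ (Submodule.subset_span ⟨σ, rfl⟩)
  · rw [Submodule.span_le]
    rintro _ ⟨σ, rfl⟩
    rw [SetLike.mem_coe, ← Submodule.smul_mem_iff _ hn]
    exact Submodule.subset_span ⟨σ, rfl⟩

end

section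

/-! ### Gaussian integrals of polynomials -/

section Gaussian

open MeasureTheory MvPolynomial

variable {N : ℕ}

theorem evalAt_add (P Q : TensorPoly N) (Φ : Idx N → ℂ) :
    evalAt (P + Q) Φ = evalAt P Φ + evalAt Q Φ := by simp [evalAt]

theorem evalAt_mul (P Q : TensorPoly N) (Φ : Idx N → ℂ) :
    evalAt (P * Q) Φ = evalAt P Φ * evalAt Q Φ := by simp [evalAt]

theorem evalAt_smul (c : ℂ) (P : TensorPoly N) (Φ : Idx N → ℂ) :
    evalAt (c • P) Φ = c * evalAt P Φ := by simp [evalAt]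

theorem evalAt_C (c : ℂ) (Φ : Idx N → ℂ) : evalAt (C c : TensorPoly N) Φ = c := by simp [evalAt]

theorem norm_exp_neg_mul_conj (z : ℂ) :
    ‖Complex.exp (-(z * starRingEnd ℂ z))‖ = Real.exp (-‖z‖ ^ 2) := by
  rw [Complex.norm_exp, Complex.mul_conj, Complex.normSq_eq_norm_sq]
  simp [-Complex.ofReal_pow]

theorem integrable_exp_neg_mul_norm_sq {b : ℝ} (hb : 0 < b) :
    Integrable (fun z : ℂ => Real.exp (-(b * ‖z‖ ^ 2))) := by
  have h := (GaussianFourier.integrable_cexp_neg_mul_sq_norm_add (V := ℂ) (b := b)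
    (by simpa using hb) 0 0).norm
  refine h.congr (Filter.Eventually.of_forall fun z => ?_)
  simp only [Complex.norm_exp]
  congr 1
  simp [← Complex.ofReal_pow]

/-- Half of the Gaussian is spent on the power: `t ^ k ≤ 1 + t ^ (2k)`, and the term of order `k` in
the series of `exp (t² / 2)` produces the constant `2 ^ k * k !`. -/
theorem pow_mul_exp_neg_sq_le (k : ℕ) (t : ℝ) (ht : 0 ≤ t) :
    t ^ k * Real.exp (-t ^ 2) ≤
      Real.exp (-(1 * t ^ 2)) + 2 ^ k * k ! * Real.exp (-(1 / 2 * t ^ 2)) := by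
  have h1 : t ^ k ≤ 1 + (t ^ 2) ^ k := by
    rcases le_total t 1 with h | h
    · have := pow_le_one₀ (n := k) ht h
      have : 0 ≤ (t ^ 2) ^ k := by positivity
      linarith
    · have : t ^ k ≤ (t ^ 2) ^ k := pow_le_pow_left₀ ht (by nlinarith) k
      linarith
  have h2 : (t ^ 2) ^ k ≤ 2 ^ k * k ! * Real.exp (1 / 2 * t ^ 2) := by
    have := Real.pow_div_factorial_le_exp (1 / 2 * t ^ 2) (by positivity) k
    rw [div_le_iff₀ (by positivity), mul_pow, div_pow, one_pow, div_mul_eq_mul_div, one_mul,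
      div_le_iff₀ (by positivity)] at this
    linarith
  have h3 : Real.exp (1 / 2 * t ^ 2) * Real.exp (-t ^ 2) = Real.exp (-(1 / 2 * t ^ 2)) := by
    rw [← Real.exp_add]
    ring_nf
  calc t ^ k * Real.exp (-t ^ 2)
      ≤ (1 + 2 ^ k * k ! * Real.exp (1 / 2 * t ^ 2)) * Real.exp (-t ^ 2) := by
        gcongr
        linarith
    _ = _ := by rw [add_mul, mul_assoc, h3]; simp

theorem integrable_pow_mul_pow_mul_exp (a b : ℕ) :
    Integrable fun z : ℂ => z ^ a * starRingEnd ℂ z ^ b * Complex.exp (-(z * starRingEnd ℂ z)) := by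
  refine Integrable.mono' ((integrable_exp_neg_mul_norm_sq one_pos).add
    ((integrable_exp_neg_mul_norm_sq one_half_pos).const_mul (2 ^ (a + b) * (a + b)! : ℝ))) ?_ ?_
  · exact Continuous.aestronglyMeasurable (by fun_prop)
  · refine Filter.Eventually.of_forall fun z => ?_
    rw [norm_mul, norm_exp_neg_mul_conj, norm_mul, norm_pow, norm_pow, RCLike.norm_conj, ← pow_add]
    exact pow_mul_exp_neg_sq_le _ _ (norm_nonneg z)

theorem gaussianWeight_eq_prod (Φ : Idx N → ℂ) :
    gaussianWeight Φ = ∏ x, Complex.exp (-(Φ x * starRingEnd ℂ (Φ x))) := by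
  rw [gaussianWeight, ← Finset.sum_neg_distrib, Complex.exp_sum]

theorem integrable_evalAt_mul_gaussianWeight (P : TensorPoly N) :
    Integrable fun Φ : Idx N → ℂ => evalAt P Φ * gaussianWeight Φ := by
  induction P using MvPolynomial.induction_on' with
  | monomial s c =>
    -- A monomial times the weight factorises over the components of the tensor, which reduces
    -- integrability to one complex variable.
    have h : Integrable fun Φ : Idx N → ℂ => ∏ x, (Φ x ^ s (Sum.inl x) *
        starRingEnd ℂ (Φ x) ^ s (Sum.inr x) * Complex.exp (-(Φ x * starRingEnd ℂ (Φ x)))) :=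
      Integrable.fintype_prod (f := fun x z => z ^ s (Sum.inl x) *
        starRingEnd ℂ z ^ s (Sum.inr x) * Complex.exp (-(z * starRingEnd ℂ z)))
        fun x => integrable_pow_mul_pow_mul_exp _ _
    refine (h.const_mul c).congr (Filter.Eventually.of_forall fun Φ => ?_)
    simp only [evalAt, eval_monomial, gaussianWeight_eq_prod]
    rw [Finsupp.prod_fintype _ _ (by simp), Fintype.prod_sum_type, Finset.prod_mul_distrib,
      Finset.prod_mul_distrib]
    simp [mul_assoc]
  | add P Q hP hQ =>
    simp_rw [evalAt_add, add_mul]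
    exact hP.add hQ

/-- The unnormalised Gaussian integral of a polynomial. -/
def gaussianIntegral (N : ℕ) : TensorPoly N →ₗ[ℂ] ℂ where
  toFun P := ∫ Φ : Idx N → ℂ, evalAt P Φ * gaussianWeight Φ
  map_add' P Q := by
    simp_rw [evalAt_add, add_mul]
    exact integral_add (integrable_evalAt_mul_gaussianWeight P)
      (integrable_evalAt_mul_gaussianWeight Q)
  map_smul' c P := by
    simp_rw [evalAt_smul, mul_assoc]
    exact integral_const_mul _ _

theorem integral_gaussianWeight_ne_zero : ∫ Φ : Idx N → ℂ, gaussianWeight Φ ≠ 0 := by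
  have h : ∀ Φ : Idx N → ℂ, gaussianWeight Φ = (Real.exp (-∑ x, ‖Φ x‖ ^ 2) : ℝ) := by
    intro Φ
    rw [gaussianWeight]
    simp_rw [Complex.mul_conj, Complex.normSq_eq_norm_sq]
    push_cast
    rfl
  have hi : Integrable fun Φ : Idx N → ℂ => Real.exp (-∑ x, ‖Φ x‖ ^ 2) := by
    have := (integrable_evalAt_mul_gaussianWeight (C 1 : TensorPoly N)).norm
    refine this.congr (Filter.Eventually.of_forall fun Φ => ?_)
    simp only [evalAt_C, one_mul, h, Complex.norm_real, Real.norm_eq_abs, Real.abs_exp]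
  simp_rw [h]
  rw [integral_complex_ofReal, Complex.ofReal_ne_zero]
  exact (integral_exp_pos hi).ne'

/-- The exponent of the Gaussian weight, as a polynomial. -/
def quadraticForm (N : ℕ) : TensorPoly N := ∑ x, X (Sum.inl x) * X (Sum.inr x)

theorem gaussianWeight_eq (Φ : Idx N → ℂ) :
    gaussianWeight Φ = Complex.exp (-evalAt (quadraticForm N) Φ) := by
  simp [gaussianWeight, quadraticForm, evalAt]

/-- The derivative of a polynomial in the direction `c` of the component `x`. -/
def dirDeriv (x : Idx N) (c : ℂ) (P : TensorPoly N) : TensorPoly N :=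
  c • pderiv (Sum.inl x) P + starRingEnd ℂ c • pderiv (Sum.inr x) P

theorem hasLineDerivAt_evalAt (x : Idx N) (c : ℂ) (P : TensorPoly N) (Φ : Idx N → ℂ) :
    HasLineDerivAt ℝ (evalAt P) (evalAt (dirDeriv x c P) Φ) Φ (Pi.single x c) := by
  unfold HasLineDerivAt
  induction P using MvPolynomial.induction_on with
  | C a => simpa [evalAt, dirDeriv] using hasDerivAt_const (0 : ℝ) a
  | add P Q hP hQ =>
    have h := hP.add hQ
    have h1 : dirDeriv x c (P + Q) = dirDeriv x c P + dirDeriv x c Q := by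
      simp only [dirDeriv, map_add, smul_add]
      ring
    rw [h1, evalAt_add]
    refine h.congr_of_eventuallyEq (Filter.Eventually.of_forall fun t => ?_)
    simp [evalAt_add]
  | mul_X P u hP =>
    have hX : HasDerivAt (fun t : ℝ => evalAt (X u : TensorPoly N) (Φ + t • (Pi.single x c : Idx N → ℂ)))
        (evalAt (dirDeriv x c (X u)) Φ) 0 := by
      have hlin : HasDerivAt (fun t : ℝ => (t : ℂ)) 1 0 := Complex.ofRealCLM.hasDerivAt
      rcases u with y | y
      · have h := (hlin.mul_const ((Pi.single x c : Idx N → ℂ) y)).const_add (Φ y)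
        have e : evalAt (dirDeriv x c (X (Sum.inl y))) Φ = 1 * (Pi.single x c : Idx N → ℂ) y := by
          by_cases hxy : x = y
          · subst hxy
            simp [evalAt, dirDeriv, pderiv_X]
          · simp [evalAt, dirDeriv, pderiv_X, Ne.symm hxy]
        rw [e]
        refine h.congr_of_eventuallyEq (Filter.Eventually.of_forall fun t => ?_)
        simp [evalAt]
      · have h := (hlin.mul_const (starRingEnd ℂ ((Pi.single x c : Idx N → ℂ) y))).const_add
          (starRingEnd ℂ (Φ y))
        have e : evalAt (dirDeriv x c (X (Sum.inr y))) Φ =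
            1 * starRingEnd ℂ ((Pi.single x c : Idx N → ℂ) y) := by
          by_cases hxy : x = y
          · subst hxy
            simp [evalAt, dirDeriv, pderiv_X]
          · simp [evalAt, dirDeriv, pderiv_X, Ne.symm hxy]
        rw [e]
        refine h.congr_of_eventuallyEq (Filter.Eventually.of_forall fun t => ?_)
        simp [evalAt]
    have h := hP.mul hX
    have h1 : dirDeriv x c (P * X u) = dirDeriv x c P * X u + P * dirDeriv x c (X u) := by
      simp only [dirDeriv, Derivation.leibniz, smul_add, smul_eq_mul, mul_add, add_mul,
        smul_mul_assoc, mul_smul_comm]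
      ring_nf
    rw [h1, evalAt_add, evalAt_mul, evalAt_mul]
    simp only [zero_smul, add_zero] at h
    refine h.congr_of_eventuallyEq (Filter.Eventually.of_forall fun t => ?_)
    simp [evalAt_mul]

theorem hasLineDerivAt_gaussianWeight (x : Idx N) (c : ℂ) (Φ : Idx N → ℂ) :
    HasLineDerivAt ℝ gaussianWeight
      (gaussianWeight Φ * -evalAt (dirDeriv x c (quadraticForm N)) Φ) Φ (Pi.single x c) := by
  have h := (hasLineDerivAt_evalAt x c (quadraticForm N) Φ)
  unfold HasLineDerivAt at h ⊢
  have h2 := h.neg.cexp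
  simp only [Pi.neg_apply, zero_smul, add_zero] at h2
  rw [gaussianWeight_eq]
  refine h2.congr_of_eventuallyEq (Filter.Eventually.of_forall fun t => ?_)
  simp [gaussianWeight_eq]

/-- The integral of the derivative of `P` times the weight vanishes, and the weight is the
exponential of minus `quadraticForm`. -/
theorem gaussianIntegral_dirDeriv (x : Idx N) (c : ℂ) (P : TensorPoly N) :
    gaussianIntegral N (P * dirDeriv x c (quadraticForm N)) =
      gaussianIntegral N (dirDeriv x c P) := by
  have h := integral_bilinear_hasLineDerivAt_right_eq_neg_left_of_integrable
    (μ := (volume : Measure (Idx N → ℂ))) (B := ContinuousLinearMap.mul ℝ ℂ)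
    (f := evalAt P) (f' := evalAt (dirDeriv x c P)) (g := gaussianWeight)
    (g' := fun Φ => gaussianWeight Φ * -evalAt (dirDeriv x c (quadraticForm N)) Φ)
    (v := Pi.single x c) ?_ ?_ ?_ (fun Φ _ => hasLineDerivAt_evalAt x c P Φ)
    (fun Φ _ => hasLineDerivAt_gaussianWeight x c Φ)
  · simp only [ContinuousLinearMap.mul_apply'] at h
    change ∫ Φ, _ = ∫ Φ, _
    rw [← neg_inj, ← h, ← integral_neg]
    refine integral_congr_ae (Filter.Eventually.of_forall fun Φ => ?_)
    simp only [evalAt_mul]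
    ring
  · exact integrable_evalAt_mul_gaussianWeight _
  · refine (integrable_evalAt_mul_gaussianWeight (P * dirDeriv x c (quadraticForm N))).neg.congr
      (Filter.Eventually.of_forall fun Φ => ?_)
    simp only [ContinuousLinearMap.mul_apply', Pi.neg_apply, evalAt_mul]
    ring
  · exact integrable_evalAt_mul_gaussianWeight _

theorem dirDeriv_quadraticForm (x : Idx N) (c : ℂ) :
    dirDeriv x c (quadraticForm N) =
      c • X (Sum.inr x) + starRingEnd ℂ c • X (Sum.inl x) := by
  simp [dirDeriv, quadraticForm, Derivation.leibniz, pderiv_X, Pi.single_apply]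

/-- Integration by parts for Gaussian integrals. -/
theorem gaussianIntegral_X_mul (u : Idx N ⊕ Idx N) (P : TensorPoly N) :
    gaussianIntegral N (X u * P) = gaussianIntegral N (pderiv u.swap P) := by
  have key : ∀ x : Idx N,
      gaussianIntegral N (X (Sum.inl x) * P) = gaussianIntegral N (pderiv (Sum.inr x) P) ∧
      gaussianIntegral N (X (Sum.inr x) * P) = gaussianIntegral N (pderiv (Sum.inl x) P) := by
    intro x
    -- The real directions `1` and `i` of a complex component give two relations, whose combinations
    -- separate the derivatives in `Φ` and `Φ̄`.
    have h1 := gaussianIntegral_dirDeriv x 1 P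
    have h2 := gaussianIntegral_dirDeriv x Complex.I P
    rw [dirDeriv_quadraticForm] at h1 h2
    simp only [dirDeriv, mul_add, mul_smul_comm, map_add, map_smul, smul_eq_mul, map_one,
      Complex.conj_I, one_mul] at h1 h2
    have h3 := congrArg (fun z => -Complex.I * z) h2
    simp only [mul_add, ← mul_assoc, neg_mul, mul_neg, Complex.I_mul_I, neg_neg, one_mul] at h3
    rw [mul_comm _ P, mul_comm _ P]
    constructor
    · linear_combination (h1 - h3) / 2
    · linear_combination (h1 + h3) / 2
  rcases u with x | x
  · exact (key x).1
  · exact (key x).2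

end Gaussian

end

section

/-! ### Normal ordering -/

section NormalOrder

open MvPolynomial

variable {N : ℕ}

/-- The contraction operator as a linear map. -/
def contractionHom (N : ℕ) : Module.End ℂ (TensorPoly N) :=
  ∑ x : Idx N, (pderiv (Sum.inl x)).toLinearMap * (pderiv (Sum.inr x)).toLinearMap

theorem contractionHom_apply (P : TensorPoly N) : contractionHom N P = contraction P := by
  simp [contractionHom, contraction]

theorem contraction_iterate (k : ℕ) (P : TensorPoly N) :
    contraction^[k] P = (contractionHom N ^ k) P := by
  rw [Module.End.pow_apply]
  congr 1
  funext Q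
  exact (contractionHom_apply Q).symm

theorem contractionHom_pow_monomial (k : ℕ) (s : Idx N ⊕ Idx N →₀ ℕ) (c : ℂ) (h : s.degree < k) :
    (contractionHom N ^ k) (monomial s c) = 0 := by
  induction k generalizing s c with
  | zero => simp at h
  | succ k ih =>
    rw [pow_succ, Module.End.mul_apply, contractionHom_apply, contraction, map_sum]
    refine Finset.sum_eq_zero fun x _ => ?_
    rw [pderiv_monomial, pderiv_monomial]
    -- With truncated subtraction the exponent would not drop here, but the coefficient is then
    -- zero. Otherwise the `Φ̄` derivative alone lowers the degree strictly, which is all the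
    -- induction needs.
    by_cases h0 : s (Sum.inr x) = 0
    · simp [h0]
    · refine ih _ _ ?_
      have hle : ∀ (u : Idx N ⊕ Idx N) (t : Idx N ⊕ Idx N →₀ ℕ),
          (t - Finsupp.single u 1).degree ≤ t.degree := fun u t =>
        Finsupp.degree_mono tsub_le_self
      refine (hle _ _).trans_lt ?_
      have h1 : s - Finsupp.single (Sum.inr x) 1 + Finsupp.single (Sum.inr x) 1 = s :=
        tsub_add_cancel_of_le (by
          rw [Finsupp.single_le_iff]
          omega)
      have h2 := congrArg Finsupp.degree h1
      rw [map_add, Finsupp.degree_single] at h2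
      omega

theorem contractionHom_pow_eq_zero {P : TensorPoly N} {k : ℕ} (h : P.totalDegree < k) :
    (contractionHom N ^ k) P = 0 := by
  rw [P.as_sum, map_sum]
  refine Finset.sum_eq_zero fun s hs => contractionHom_pow_monomial k s _ ?_
  exact (le_totalDegree hs).trans_lt h

/-- All terms beyond the degree vanish, so several polynomials can share one truncation; this makes
normal ordering linear and lets it commute with derivatives. -/
theorem normalOrder_eq_sum {P : TensorPoly N} {M : ℕ} (h : P.totalDegree < M) :
    normalOrder P =
      ∑ k ∈ Finset.range M, ((-1 : ℂ) ^ k / (k ! : ℂ)) • (contractionHom N ^ k) P := by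
  rw [normalOrder]
  simp_rw [contraction_iterate]
  refine Finset.sum_subset (Finset.range_mono h) fun k _ hk => ?_
  rw [contractionHom_pow_eq_zero, smul_zero]
  simpa [Nat.lt_succ_iff] using hk

/-- Normal ordering as a linear map. -/
def normalOrderHom (N : ℕ) : TensorPoly N →ₗ[ℂ] TensorPoly N where
  toFun := normalOrder
  map_add' P Q := by
    set M := max (P + Q).totalDegree (max P.totalDegree Q.totalDegree) + 1 with hM
    rw [normalOrder_eq_sum (P := P + Q) (M := M) (by omega),
      normalOrder_eq_sum (P := P) (M := M) (by omega),
      normalOrder_eq_sum (P := Q) (M := M) (by omega), ← Finset.sum_add_distrib]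
    simp only [map_add, smul_add]
  map_smul' c P := by
    set M := max (c • P).totalDegree P.totalDegree + 1 with hM
    rw [normalOrder_eq_sum (P := c • P) (M := M) (by omega),
      normalOrder_eq_sum (P := P) (M := M) (by omega), Finset.smul_sum]
    refine Finset.sum_congr rfl fun k _ => ?_
    rw [map_smul, smul_comm]
    rfl

theorem normalOrder_C (c : ℂ) : normalOrder (C c : TensorPoly N) = C c := by
  simp [normalOrder]

/-- The commutator of two derivations is a derivation, and this one kills every variable. -/
theorem pderiv_comm (u v : Idx N ⊕ Idx N) (P : TensorPoly N) :
    pderiv u (pderiv v P) = pderiv v (pderiv u P) := by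
  have h : ⁅(pderiv u : Derivation ℂ (TensorPoly N) (TensorPoly N)),
      (pderiv v : Derivation ℂ (TensorPoly N) (TensorPoly N))⁆ = 0 := by
    ext1 w
    simp [Derivation.commutator_apply, pderiv_X, Pi.single_apply, apply_ite]
  have := Derivation.congr_fun h P
  rwa [Derivation.commutator_apply, Derivation.zero_apply, sub_eq_zero] at this

theorem contractionHom_pow_pderiv (u : Idx N ⊕ Idx N) (k : ℕ) (P : TensorPoly N) :
    (contractionHom N ^ k) (pderiv u P) = pderiv u ((contractionHom N ^ k) P) := by
  induction k generalizing P with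
  | zero => simp
  | succ k ih =>
    rw [pow_succ, Module.End.mul_apply, Module.End.mul_apply, ← ih]
    congr 1
    simp only [contractionHom_apply, contraction, map_sum]
    refine Finset.sum_congr rfl fun x _ => ?_
    rw [pderiv_comm (Sum.inr x) u, pderiv_comm (Sum.inl x) u]

theorem normalOrder_pderiv (u : Idx N ⊕ Idx N) (P : TensorPoly N) :
    normalOrder (pderiv u P) = pderiv u (normalOrder P) := by
  set M := max (pderiv u P).totalDegree P.totalDegree + 1 with hM
  rw [normalOrder_eq_sum (P := pderiv u P) (M := M) (by omega),
    normalOrder_eq_sum (P := P) (M := M) (by omega), map_sum]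
  simp_rw [contractionHom_pow_pderiv, Derivation.map_smul]

theorem contractionHom_X_mul (u : Idx N ⊕ Idx N) (P : TensorPoly N) :
    contractionHom N (X u * P) = X u * contractionHom N P + pderiv u.swap P := by
  simp only [contractionHom_apply, contraction]
  rcases u with x | x
  · simp [Derivation.leibniz, pderiv_X, Pi.single_apply, Finset.sum_add_distrib, Finset.mul_sum]
  · simp_rw [pderiv_comm (Sum.inl _) (Sum.inr _)]
    simp [Derivation.leibniz, pderiv_X, Pi.single_apply, Finset.sum_add_distrib, Finset.mul_sum]

/-- The commutator of the contraction with multiplication by `X u` is the derivative in the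
conjugate variable, which itself commutes with the contraction; hence the power rule with factor `k
+ 1`. -/
theorem contractionHom_pow_succ_X_mul (u : Idx N ⊕ Idx N) (k : ℕ) (P : TensorPoly N) :
    (contractionHom N ^ (k + 1)) (X u * P) = X u * (contractionHom N ^ (k + 1)) P +
      ((k + 1 : ℕ) : ℂ) • pderiv u.swap ((contractionHom N ^ k) P) := by
  induction k with
  | zero => simp [contractionHom_X_mul]
  | succ k ih =>
    have h1 : ∀ Q, contractionHom N (pderiv u.swap Q) = pderiv u.swap (contractionHom N Q) :=
      fun Q => by simpa using contractionHom_pow_pderiv u.swap 1 Q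
    have h2 : ∀ j, contractionHom N ((contractionHom N ^ j) P) = (contractionHom N ^ (j + 1)) P :=
      fun j => by rw [pow_succ', Module.End.mul_apply]
    rw [pow_succ', Module.End.mul_apply, ih, map_add, contractionHom_X_mul, map_smul, h1, h2, h2,
      add_assoc]
    congr 1
    · rw [pow_succ']
    · rw [Nat.cast_succ (k + 1), add_smul, one_smul, add_comm]

/-- This is the exponentiated commutator `e^{-Δ} X u = (X u - ∂) e^{-Δ}`, with `∂` the derivative in
the conjugate variable. -/
theorem normalOrder_X_mul (u : Idx N ⊕ Idx N) (P : TensorPoly N) :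
    normalOrder (X u * P) = X u * normalOrder P - pderiv u.swap (normalOrder P) := by
  obtain ⟨M, hM₁, hM₂⟩ : ∃ M, (X u * P).totalDegree < M ∧ P.totalDegree < M :=
    ⟨max (X u * P).totalDegree P.totalDegree + 1, by omega, by omega⟩
  have h1 : normalOrder P = ∑ k ∈ Finset.range M, ((-1 : ℂ) ^ k / (k ! : ℂ)) •
      (contractionHom N ^ k) P := normalOrder_eq_sum (by omega)
  have h2 : pderiv u.swap (normalOrder P) = ∑ k ∈ Finset.range M, ((-1 : ℂ) ^ k / (k ! : ℂ)) •
      pderiv u.swap ((contractionHom N ^ k) P) := by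
    rw [h1, map_sum]
    simp_rw [Derivation.map_smul]
  -- The normal-ordered polynomials are truncated one step later than the derivative term: after
  -- splitting off the zeroth term, the term of order `k + 1` matches the derivative of order `k`.
  rw [h2, normalOrder_eq_sum (P := X u * P) (M := M + 1) (by omega),
    normalOrder_eq_sum (P := P) (M := M + 1) (by omega), Finset.sum_range_succ',
    Finset.sum_range_succ']
  simp only [contractionHom_pow_succ_X_mul]
  rw [mul_add, Finset.mul_sum, add_sub_right_comm, ← Finset.sum_sub_distrib]
  congr 1
  · refine Finset.sum_congr rfl fun k _ => ?_
    rw [smul_add, mul_smul_comm, smul_smul, sub_eq_add_neg, ← neg_smul]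
    congr 2
    rw [Nat.factorial_succ, pow_succ]
    have : ((k + 1 : ℕ) : ℂ) ≠ 0 := by exact_mod_cast k.succ_ne_zero
    have : (k ! : ℂ) ≠ 0 := by exact_mod_cast k.factorial_ne_zero
    push_cast at *
    field_simp
  · simp

/-! ### Wick's theorem for normal-ordered products -/

/-- The iterated derivative along a family of variables. -/
def iterPderiv : (m : ℕ) → (Fin m → Idx N ⊕ Idx N) → TensorPoly N →ₗ[ℂ] TensorPoly N
  | 0, _ => LinearMap.id
  | m + 1, w => iterPderiv m (fun a => w a.succ) ∘ₗ (pderiv (w 0)).toLinearMap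

theorem iterPderiv_succ (m : ℕ) (w : Fin (m + 1) → Idx N ⊕ Idx N) (P : TensorPoly N) :
    iterPderiv (m + 1) w P = iterPderiv m (fun a => w a.succ) (pderiv (w 0) P) := rfl

theorem normalOrder_iterPderiv (m : ℕ) (w : Fin m → Idx N ⊕ Idx N) (P : TensorPoly N) :
    normalOrder (iterPderiv m w P) = iterPderiv m w (normalOrder P) := by
  induction m generalizing P with
  | zero => rfl
  | succ m ih => rw [iterPderiv_succ, ih, normalOrder_pderiv, iterPderiv_succ]

/-- Integration by parts lets `X u` differentiate both factors; the correction from normal ordering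
cancels exactly the derivative of `P`, the self-contraction. -/
theorem gaussianIntegral_normalOrder_X_mul (u : Idx N ⊕ Idx N) (P Q : TensorPoly N) :
    gaussianIntegral N (normalOrder (X u * P) * Q) =
      gaussianIntegral N (normalOrder P * pderiv u.swap Q) := by
  rw [normalOrder_X_mul, sub_mul, map_sub, mul_assoc, gaussianIntegral_X_mul, Derivation.leibniz,
    map_add, smul_eq_mul, smul_eq_mul, mul_comm Q]
  ring

theorem gaussianIntegral_normalOrder_prod_mul (m : ℕ) (w : Fin m → Idx N ⊕ Idx N)
    (P Q : TensorPoly N) :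
    gaussianIntegral N (normalOrder ((∏ a, X (w a)) * P) * Q) =
      gaussianIntegral N (normalOrder P * iterPderiv m (fun a => (w a).swap) Q) := by
  induction m generalizing Q with
  | zero => simp [iterPderiv]
  | succ m ih =>
    rw [Fin.prod_univ_succ, mul_assoc, gaussianIntegral_normalOrder_X_mul, ih]
    rfl

/-- Leibniz's rule deletes one factor `b` at a time. The remaining factors are enumerated through
`Equiv.swap 0 b` so as to match `Equiv.Perm.decomposeFin` in the recursion over pairings. -/
theorem pderiv_prod_X_mul (m : ℕ) (u : Idx N ⊕ Idx N) (v : Fin (m + 1) → Idx N ⊕ Idx N)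
    (P : TensorPoly N) (hP : pderiv u P = 0) :
    pderiv u ((∏ b, X (v b)) * P) = ∑ b, (if u = v b then (1 : ℂ) else 0) •
      ((∏ a : Fin m, X (v (Equiv.swap 0 b a.succ))) * P) := by
  have h1 : pderiv u (∏ b, X (v b) : TensorPoly N) = ∑ b, (if u = v b then (1 : ℂ) else 0) •
      ∏ a : Fin m, X (v (Equiv.swap 0 b a.succ)) := by
    have h2 : pderiv u (∏ b, X (v b) : TensorPoly N) =
        ∑ b, (∏ a ∈ Finset.univ.erase b, (X (v a) : TensorPoly N)) •
          pderiv u (X (v b) : TensorPoly N) := by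
      generalize (Finset.univ : Finset (Fin (m + 1))) = s
      induction s using Finset.induction_on with
      | empty => simp
      | insert c s hc ih =>
        rw [Finset.prod_insert hc, Derivation.leibniz, ih, Finset.sum_insert hc,
          Finset.erase_insert hc, add_comm, Finset.smul_sum]
        congr 1
        refine Finset.sum_congr rfl fun b hb => ?_
        have hbc : c ≠ b := fun h => hc (h ▸ hb)
        rw [Finset.erase_insert_of_ne hbc, Finset.prod_insert (fun h => hc (Finset.mem_of_mem_erase h)),
          smul_smul]
    rw [h2]
    refine Finset.sum_congr rfl fun b _ => ?_
    have h3 : ∏ a ∈ Finset.univ.erase b, (X (v a) : TensorPoly N) =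
        ∏ a : Fin m, X (v (Equiv.swap 0 b a.succ)) := by
      have h4 : Finset.univ.erase b =
          Finset.univ.map ((Fin.succEmb m).trans (Equiv.swap 0 b).toEmbedding) := by
        ext c
        simp only [Finset.mem_erase, Finset.mem_univ, and_true, Finset.mem_map, true_and,
          Function.Embedding.trans_apply, Fin.coe_succEmb, Equiv.coe_toEmbedding]
        constructor
        · intro hc
          have : Equiv.swap 0 b c ≠ 0 := by
            rw [Ne, Equiv.swap_apply_eq_iff, Equiv.swap_apply_left]
            exact hc
          obtain ⟨a, ha⟩ := Fin.exists_succ_eq.2 this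
          exact ⟨a, by rw [ha, Equiv.swap_apply_self]⟩
        · rintro ⟨a, rfl⟩ h
          rw [Equiv.swap_apply_eq_iff, Equiv.swap_apply_right] at h
          exact Fin.succ_ne_zero a h
      rw [h4, Finset.prod_map]
      rfl
    rw [h3, pderiv_X, Pi.single_apply]
    by_cases hu : u = v b
    · rw [if_pos hu, if_pos hu.symm, smul_eq_mul, mul_one, one_smul]
    · rw [if_neg hu, if_neg (Ne.symm hu), smul_zero, zero_smul]
  rw [Derivation.leibniz, hP, smul_zero, zero_add, h1, smul_eq_mul, Finset.mul_sum]
  refine Finset.sum_congr rfl fun b _ => ?_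
  rw [mul_smul_comm, mul_comm]

theorem iterPderiv_prod_X_mul (m : ℕ) (w v : Fin m → Idx N ⊕ Idx N) (P : TensorPoly N)
    (hP : ∀ a, pderiv (w a) P = 0) :
    iterPderiv m w ((∏ b, X (v b)) * P) =
      (∑ α : Equiv.Perm (Fin m), if ∀ a, w a = v (α a) then (1 : ℂ) else 0) • P := by
  induction m with
  | zero => simp [iterPderiv]
  | succ m ih =>
    rw [iterPderiv_succ, pderiv_prod_X_mul m (w 0) v P (hP 0), map_sum]
    simp_rw [map_smul]
    rw [Finset.sum_congr rfl fun b _ => congrArg _ (ih (fun a => w a.succ)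
      (fun a => v (Equiv.swap 0 b a.succ)) fun a => hP a.succ)]
    simp_rw [smul_smul]
    rw [← Finset.sum_smul]
    congr 1
    -- A pairing amounts to the partner `b` of `0` together with a pairing of what is left.
    rw [← Equiv.sum_comp Equiv.Perm.decomposeFin.symm, Fintype.sum_prod_type]
    refine Finset.sum_congr rfl fun b _ => ?_
    rw [Finset.mul_sum]
    refine Finset.sum_congr rfl fun β _ => ?_
    rw [ite_mul, one_mul, zero_mul, ← ite_and]
    congr 1
    rw [eq_iff_iff, Fin.forall_fin_succ]
    simp

end NormalOrder

end

section

/-! ### Two-point functions of permutation observables -/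

section TwoPoint

open MeasureTheory MvPolynomial

variable {N : ℕ}

/-- Complex conjugation of polynomial observables. -/
def conjPoly (N : ℕ) : TensorPoly N →+* TensorPoly N :=
  (rename Sum.swap : TensorPoly N →ₐ[ℂ] TensorPoly N).toRingHom.comp
    (MvPolynomial.map (starRingEnd ℂ))

theorem conjPoly_X (u : Idx N ⊕ Idx N) : conjPoly N (X u) = X u.swap := by simp [conjPoly]

theorem conjPoly_C (c : ℂ) : conjPoly N (C c) = C (starRingEnd ℂ c) := by
  simp [conjPoly]

theorem conjPoly_smul (c : ℂ) (P : TensorPoly N) :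
    conjPoly N (c • P) = starRingEnd ℂ c • conjPoly N P := by
  rw [smul_eq_C_mul, map_mul, conjPoly_C, ← smul_eq_C_mul]

theorem evalAt_conjPoly (P : TensorPoly N) (Φ : Idx N → ℂ) :
    evalAt (conjPoly N P) Φ = starRingEnd ℂ (evalAt P Φ) := by
  induction P using MvPolynomial.induction_on with
  | C a => rw [conjPoly_C, evalAt_C, evalAt_C]
  | add P Q hP hQ => rw [map_add, evalAt_add, hP, hQ, evalAt_add, map_add]
  | mul_X P u hP =>
    rw [map_mul, evalAt_mul, hP, evalAt_mul, map_mul, conjPoly_X]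
    rcases u with u | u <;> simp [evalAt]

theorem pderiv_swap_conjPoly (u : Idx N ⊕ Idx N) (P : TensorPoly N) :
    pderiv u.swap (conjPoly N P) = conjPoly N (pderiv u P) := by
  induction P using MvPolynomial.induction_on with
  | C a => simp [conjPoly_C]
  | add P Q hP hQ => simp only [map_add, hP, hQ]
  | mul_X P v hP =>
    rw [map_mul, Derivation.leibniz, hP, conjPoly_X, Derivation.leibniz, map_add, smul_eq_mul,
      smul_eq_mul, smul_eq_mul, smul_eq_mul, map_mul, map_mul, conjPoly_X]
    congr 2
    by_cases h : v = u
    · subst h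
      simp
    · rw [pderiv_X_of_ne h, pderiv_X_of_ne (fun h' => h (Sum.swap_leftInverse.injective h')),
        map_zero]

theorem contractionHom_conjPoly (P : TensorPoly N) :
    contractionHom N (conjPoly N P) = conjPoly N (contractionHom N P) := by
  simp only [contractionHom_apply, contraction, map_sum]
  refine Finset.sum_congr rfl fun x _ => ?_
  rw [← pderiv_swap_conjPoly, ← pderiv_swap_conjPoly, pderiv_comm]
  rfl

theorem normalOrder_conjPoly (P : TensorPoly N) :
    normalOrder (conjPoly N P) = conjPoly N (normalOrder P) := by
  obtain ⟨M, hM₁, hM₂⟩ : ∃ M, (conjPoly N P).totalDegree < M ∧ P.totalDegree < M :=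
    ⟨max (conjPoly N P).totalDegree P.totalDegree + 1, by omega, by omega⟩
  have h : ∀ k, (contractionHom N ^ k) (conjPoly N P) = conjPoly N ((contractionHom N ^ k) P) := by
    intro k
    induction k with
    | zero => rfl
    | succ k ih => rw [pow_succ', Module.End.mul_apply, ih, contractionHom_conjPoly,
        Module.End.mul_apply]
  rw [normalOrder_eq_sum hM₁, normalOrder_eq_sum hM₂, map_sum]
  refine Finset.sum_congr rfl fun k _ => ?_
  rw [conjPoly_smul, h]
  simp

theorem normalOrderedProduct_eq (P Q : TensorPoly N) (Φ : Idx N → ℂ) :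
    normalOrderedProduct P Q Φ =
      evalAt (normalOrder P * normalOrder (conjPoly N Q)) Φ := by
  rw [normalOrderedProduct, evalAt_mul, normalOrder_conjPoly, evalAt_conjPoly]

theorem integrable_normalOrderedProduct (P Q : TensorPoly N) :
    Integrable fun Φ : Idx N → ℂ => normalOrderedProduct P Q Φ * gaussianWeight Φ := by
  simp_rw [normalOrderedProduct_eq]
  exact integrable_evalAt_mul_gaussianWeight _

theorem twoPoint_eq (P Q : TensorPoly N) :
    twoPoint P Q = gaussianIntegral N (normalOrderHom N P * normalOrderHom N (conjPoly N Q)) /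
      ∫ Φ : Idx N → ℂ, gaussianWeight Φ := by
  rw [twoPoint, gaussianExpectation]
  simp_rw [normalOrderedProduct_eq]
  rfl

theorem twoPoint_sum_smul {ι κ : Type*} [Fintype ι] [Fintype κ] (f : ι → ℝ) (P : ι → TensorPoly N)
    (g : κ → ℝ) (Q : κ → TensorPoly N) :
    twoPoint (∑ i, (f i : ℂ) • P i) (∑ j, (g j : ℂ) • Q j) =
      ∑ i, ∑ j, (f i * g j : ℂ) * twoPoint (P i) (Q j) := by
  simp_rw [twoPoint_eq, map_sum, conjPoly_smul, map_smul, Finset.sum_mul_sum, map_sum,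
    Finset.sum_div, Complex.conj_ofReal, smul_mul_smul_comm, map_smul, smul_eq_mul, mul_div_assoc]

theorem pderiv_prod_X_eq_zero {m : ℕ} {u : Idx N ⊕ Idx N} {v : Fin m → Idx N ⊕ Idx N}
    (h : ∀ a, v a ≠ u) : pderiv u (∏ a, X (v a) : TensorPoly N) = 0 := by
  refine Finset.prod_induction _ (fun P : TensorPoly N => pderiv u P = 0) ?_ (by simp) ?_
  · intro P Q hP hQ
    simp [Derivation.leibniz, hP, hQ]
  · intro a _
    exact pderiv_X_of_ne (h a)

theorem gaussianIntegral_C (c : ℂ) :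
    gaussianIntegral N (C c) = c * ∫ Φ : Idx N → ℂ, gaussianWeight Φ := by
  rw [← integral_const_mul]
  simp only [gaussianIntegral, LinearMap.coe_mk, AddHom.coe_mk, evalAt_C]

/-- Wick's theorem for two normal-ordered monomials with equally many `Φ` and `Φ̄`. -/
theorem gaussianIntegral_normalOrder_mul_normalOrder {m : ℕ} (x x' y y' : Fin m → Idx N) :
    gaussianIntegral N
      (normalOrder ((∏ a, X (Sum.inl (x a))) * ∏ a, X (Sum.inr (x' a))) *
        normalOrder ((∏ a, X (Sum.inr (y a))) * ∏ a, X (Sum.inl (y' a)))) =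
      (∑ α : Equiv.Perm (Fin m), if ∀ a, x a = y (α a) then (1 : ℂ) else 0) *
      (∑ β : Equiv.Perm (Fin m), if ∀ a, x' a = y' (β a) then (1 : ℂ) else 0) *
      ∫ Φ : Idx N → ℂ, gaussianWeight Φ := by
  -- Each variable of the first monomial becomes a derivative on the second. Derivatives commute
  -- with normal ordering, so they act on the bare monomial and leave a constant.
  rw [gaussianIntegral_normalOrder_prod_mul m (fun a => Sum.inl (x a)),
    ← mul_one (∏ a, (X (Sum.inr (x' a)) : TensorPoly N)),
    gaussianIntegral_normalOrder_prod_mul m (fun a => Sum.inr (x' a)),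
    ← normalOrder_iterPderiv, ← normalOrder_iterPderiv]
  simp only [Sum.swap_inl, Sum.swap_inr]
  rw [iterPderiv_prod_X_mul m _ (fun a => Sum.inr (y a)) _
    (fun a => pderiv_prod_X_eq_zero fun b => by simp), map_smul,
    ← mul_one (∏ a, (X (Sum.inl (y' a)) : TensorPoly N)),
    iterPderiv_prod_X_mul m _ (fun a => Sum.inl (y' a)) _ (fun a => by simp)]
  rw [← C_1, normalOrder_C, C_1, one_mul, smul_smul, ← C_1, ← C_mul', C_1, mul_one, normalOrder_C,
    gaussianIntegral_C]
  simp only [Sum.inl.injEq, Sum.inr.injEq]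

variable {n : ℕ}

/-- The index of `Φ̄` attached to the index of `Φ` by three permutations. -/
def permIdx (σ : Perm3 n) (x : Fin n → Idx N) (a : Fin n) : Idx N :=
  ((x (σ.1 a)).1, (x (σ.2.1 a)).2.1, (x (σ.2.2 a)).2.2)

theorem conjPoly_permObservable (σ : Perm3 n) :
    conjPoly N (permObservable N σ) = ∑ y : Fin n → Idx N,
      (∏ a, X (Sum.inr (y a))) * ∏ a, X (Sum.inl (permIdx σ y a)) := by
  simp [permObservable, conjPoly_X, permIdx]

/-- The number of index assignments fixed by a permutation. -/
def fixCount (N : ℕ) (g : Equiv.Perm (Fin n)) : ℝ :=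
  ∑ y : Fin n → Fin N, if ∀ a, y (g a) = y a then 1 else 0

/-- The product of the numbers of index assignments fixed by three permutations. -/
def fixCount3 (N : ℕ) (σ : Perm3 n) : ℝ :=
  fixCount N σ.1 * fixCount N σ.2.1 * fixCount N σ.2.2

theorem sum_permIdx_eq (σ σ' : Perm3 n) (α β : Equiv.Perm (Fin n)) :
    ∑ y : Fin n → Idx N,
      (if ∀ a, permIdx σ (fun b => y (α b)) a = permIdx σ' y (β a) then (1 : ℝ) else 0) =
    fixCount3 N (diag α * σ * diag β⁻¹ * σ'⁻¹) := by
  have key : ∀ (s s' : Equiv.Perm (Fin n)) (z : Fin n → Fin N),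
      (∀ a, z ((α * s * β⁻¹ * s'⁻¹) a) = z a) ↔ ∀ a, z (α (s a)) = z (s' (β a)) := by
    intro s s' z
    -- Evaluating at `s' (β a)` cancels the inverses and turns the fixed-point condition into the
    -- pairing condition.
    rw [← (s' * β).forall_congr_right]
    simp
  have h : ∀ y : Fin n → Idx N,
      (if ∀ a, permIdx σ (fun b => y (α b)) a = permIdx σ' y (β a) then (1 : ℝ) else 0) =
      (if ∀ a, (y (α (σ.1 a))).1 = (y (σ'.1 (β a))).1 then 1 else 0) *
      (if ∀ a, (y (α (σ.2.1 a))).2.1 = (y (σ'.2.1 (β a))).2.1 then 1 else 0) *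
      (if ∀ a, (y (α (σ.2.2 a))).2.2 = (y (σ'.2.2 (β a))).2.2 then 1 else 0) := by
    intro y
    simp only [permIdx, Prod.mk.injEq, forall_and, ite_and]
    split_ifs <;> simp
  simp_rw [h]
  let e : (Fin n → Idx N) ≃ (Fin n → Fin N) × (Fin n → Fin N) × (Fin n → Fin N) :=
    (Equiv.arrowProdEquivProdArrow _ _ _).trans
      ((Equiv.refl _).prodCongr (Equiv.arrowProdEquivProdArrow _ _ _))
  rw [← Equiv.sum_comp e.symm]
  have h2 := sum_prod_mul_mul
    (fun z : Fin n → Fin N => if ∀ a, z (α (σ.1 a)) = z (σ'.1 (β a)) then (1 : ℝ) else 0)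
    (fun z : Fin n → Fin N => if ∀ a, z (α (σ.2.1 a)) = z (σ'.2.1 (β a)) then (1 : ℝ) else 0)
    (fun z : Fin n → Fin N => if ∀ a, z (α (σ.2.2 a)) = z (σ'.2.2 (β a)) then (1 : ℝ) else 0)
  refine Eq.trans ?_ (h2.trans ?_)
  · rfl
  · simp only [fixCount3, fixCount, diag, Prod.fst_mul, Prod.snd_mul, Prod.fst_inv, Prod.snd_inv,
      key]

/-- In Wick's sum `α` pairs the `Φ` of the first observable with the `Φ̄` of the conjugated second
one, and `β` the other way round. The constraint from `α` determines `x`; the sum over `y` then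
splits into the three tensor slots. -/
theorem twoPoint_permObservable (σ σ' : Perm3 n) :
    twoPoint (permObservable N σ) (permObservable N σ') =
      ((∑ α : Equiv.Perm (Fin n), ∑ β : Equiv.Perm (Fin n),
        fixCount3 N (diag α * σ * diag β * σ'⁻¹) : ℝ) : ℂ) := by
  have hZ := integral_gaussianWeight_ne_zero (N := N)
  have h1 : gaussianIntegral N (normalOrderHom N (permObservable N σ) *
      normalOrderHom N (conjPoly N (permObservable N σ'))) =
      (∑ x : Fin n → Idx N, ∑ y : Fin n → Idx N,
        (∑ α : Equiv.Perm (Fin n), if ∀ a, x a = y (α a) then (1 : ℂ) else 0) *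
        (∑ β : Equiv.Perm (Fin n), if ∀ a, permIdx σ x a = permIdx σ' y (β a) then (1 : ℂ) else 0)) *
      ∫ Φ : Idx N → ℂ, gaussianWeight Φ := by
    rw [conjPoly_permObservable, permObservable, map_sum, map_sum, Finset.sum_mul_sum, map_sum,
      Finset.sum_mul]
    refine Finset.sum_congr rfl fun x _ => ?_
    rw [map_sum, Finset.sum_mul]
    exact Finset.sum_congr rfl fun y _ =>
      gaussianIntegral_normalOrder_mul_normalOrder x (permIdx σ x) y (permIdx σ' y)
  rw [twoPoint_eq, h1, mul_div_assoc, div_self hZ, mul_one]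
  have h2 : ∀ α : Equiv.Perm (Fin n), ∑ β : Equiv.Perm (Fin n),
      fixCount3 N (diag α * σ * diag β * σ'⁻¹) =
      ∑ β : Equiv.Perm (Fin n), ∑ y : Fin n → Idx N,
        (if ∀ a, permIdx σ (fun b => y (α b)) a = permIdx σ' y (β a) then (1 : ℝ) else 0) := by
    intro α
    simp_rw [sum_permIdx_eq]
    exact (Equiv.sum_comp (Equiv.inv _) fun β => fixCount3 N (diag α * σ * diag β * σ'⁻¹)).symm
  simp_rw [h2]
  push_cast
  simp_rw [Finset.sum_mul_sum]
  rw [Finset.sum_comm]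
  have h3 : ∀ y : Fin n → Idx N, ∑ x : Fin n → Idx N, ∑ α : Equiv.Perm (Fin n),
      ∑ β : Equiv.Perm (Fin n), (if ∀ a, x a = y (α a) then (1 : ℂ) else 0) *
        (if ∀ a, permIdx σ x a = permIdx σ' y (β a) then (1 : ℂ) else 0) =
      ∑ α : Equiv.Perm (Fin n), ∑ β : Equiv.Perm (Fin n),
        if ∀ a, permIdx σ (fun b => y (α b)) a = permIdx σ' y (β a) then (1 : ℂ) else 0 := by
    intro y
    rw [Finset.sum_comm]
    refine Finset.sum_congr rfl fun α _ => ?_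
    rw [Finset.sum_comm]
    refine Finset.sum_congr rfl fun β _ => ?_
    rw [Finset.sum_eq_single fun b => y (α b)]
    · simp
    · intro x _ hx
      rw [if_neg, zero_mul]
      exact fun h => hx (funext h)
    · simp
  simp_rw [h3]
  rw [Finset.sum_comm]
  refine Finset.sum_congr rfl fun α _ => ?_
  rw [Finset.sum_comm]
  refine Finset.sum_congr rfl fun β _ => Finset.sum_congr rfl fun y _ => ?_
  split_ifs <;> simp

end TwoPoint

end

section

/-! ### Schur-Weyl duality and the main theorem -/

variable {n : ℕ}

/-- The standard basis of `(ℂ^N)^{⊗ n}`. -/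
def tensorBasis (n N : ℕ) : Module.Basis (Fin n → Fin N) ℂ (TensorPower n N) :=
  Basis.piTensorProduct fun _ => Pi.basisFun ℂ (Fin N)

theorem permTensorRep_tensorBasis (N : ℕ) (g : Equiv.Perm (Fin n)) (y : Fin n → Fin N) :
    permTensorRep n N g (tensorBasis n N y) = tensorBasis n N fun a => y (g⁻¹ a) := by
  rw [tensorBasis, Basis.piTensorProduct_apply, Basis.piTensorProduct_apply]
  exact PiTensorProduct.reindex_tprod (R := ℂ) (s := fun _ : Fin n => (Fin N → ℂ)) g _

/-- A permutation permutes the tensor basis, so its trace counts fixed basis vectors. -/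
theorem character_permTensorRep (N : ℕ) (g : Equiv.Perm (Fin n)) :
    (permTensorRep n N).character g = (fixCount N g : ℂ) := by
  classical
  rw [Representation.character, LinearMap.trace_eq_matrix_trace ℂ (tensorBasis n N), Matrix.trace,
    fixCount]
  push_cast
  refine Finset.sum_congr rfl fun y _ => ?_
  rw [Matrix.diag_apply, LinearMap.toMatrix_apply, permTensorRep_tensorBasis,
    Module.Basis.repr_self, Finsupp.single_apply]
  have h : ((fun a => y (g⁻¹ a)) = y) ↔ ∀ a, y (g a) = y a := by
    rw [funext_iff, ← g.forall_congr_right]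
    simp [eq_comm]
  by_cases h1 : ∀ a, y (g a) = y a
  · rw [if_pos (h.2 h1), if_pos h1, Complex.ofReal_one]
  · rw [if_neg fun h2 => h1 (h.1 h2), if_neg h1, Complex.ofReal_zero]

variable (B : OrthogonalForm n)

theorem character_spechtRep (R : Nat.Partition n) (g : Equiv.Perm (Fin n)) :
    Representation.character (k := ℂ) (V := SpechtModule R) (spechtRep R) g = (B.chi R g : ℂ) := by
  rw [Representation.character, LinearMap.trace_eq_matrix_trace ℂ (B.basis R), B.toMatrix_eq,
    OrthogonalForm.chi, Complex.ofReal_sum]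
  rfl

/-- The inner product of characters is the dimension of the space of equivariant maps, which is how
`dimU` is defined; inverses disappear since the matrices are orthogonal. -/
theorem sum_fixCount_mul_chi (N : ℕ) (R : Nat.Partition n) :
    ∑ g, fixCount N g * B.chi R g = n ! * dimU N R := by
  have : Module.Finite ℂ (SpechtModule R) := Module.Finite.of_basis (B.basis R)
  have : Module.Finite ℂ (TensorPower n N) := Module.Finite.of_basis (tensorBasis n N)
  have hn : (n ! : ℂ) ≠ 0 := by exact_mod_cast n.factorial_ne_zero
  have hc : (Nat.card (Equiv.Perm (Fin n)) : ℂ) = n ! := by simp [Fintype.card_perm]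
  let _ : Invertible (Nat.card (Equiv.Perm (Fin n)) : ℂ) := invertibleOfNonzero (by rwa [hc])
  have h := Representation.card_inv_mul_sum_char_mul_char_eq_finrank (k := ℂ)
    (V := SpechtModule R) (W := TensorPower n N) (spechtRep R) (permTensorRep n N)
  rw [hc, inv_mul_eq_iff_eq_mul₀ hn] at h
  simp_rw [character_permTensorRep, character_spechtRep B] at h
  have hinv : ∀ g, B.chi R g⁻¹ = B.chi R g := fun g =>
    Finset.sum_congr rfl fun i _ => B.D_inv_apply R g i i
  simp_rw [hinv] at h
  exact_mod_cast h

theorem fixCount_conj (N : ℕ) (h g : Equiv.Perm (Fin n)) :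
    fixCount N (h * g * h⁻¹) = fixCount N g := by
  unfold fixCount
  rw [← Equiv.sum_comp (Equiv.arrowCongr h (Equiv.refl (Fin N)))]
  refine Finset.sum_congr rfl fun y _ => ?_
  have : (∀ a, (Equiv.arrowCongr h (Equiv.refl (Fin N))) y ((h * g * h⁻¹) a) =
      (Equiv.arrowCongr h (Equiv.refl (Fin N))) y a) ↔ ∀ a, y (g a) = y a := by
    rw [← h.forall_congr_right]
    simp
  by_cases h1 : ∀ a, y (g a) = y a
  · rw [if_pos h1, if_pos (this.2 h1)]
  · rw [if_neg h1, if_neg fun h2 => h1 (this.1 h2)]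

/-- The sum of `D^R` weighted by a class function commutes with all `D^R(σ)`, hence is scalar, and
its trace is known from the character sum. -/
theorem sum_fixCount_mul_D (N : ℕ) (R : Nat.Partition n) (i j : Fin (dimS R)) :
    ∑ g, fixCount N g * B.D R g i j = if i = j then (n ! : ℝ) * dimU N R / dimS R else 0 := by
  set A : Matrix (Fin (dimS R)) (Fin (dimS R)) ℝ :=
    Matrix.of fun i j => ∑ g, fixCount N g * B.D R g i j with hA
  have hcomm : ∀ σ, A * B.D R σ = B.D R σ * A := by
    intro σ
    have hA' : A = ∑ g, fixCount N g • B.D R g := by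
      ext i j
      simp [hA, Matrix.sum_apply]
    rw [hA', Finset.sum_mul, Finset.mul_sum,
      ← Equiv.sum_comp (MulAut.conj σ).toEquiv fun g => (fixCount N g • B.D R g) * B.D R σ]
    refine Finset.sum_congr rfl fun g _ => ?_
    simp only [MulEquiv.toEquiv_eq_coe, MulEquiv.coe_toEquiv, MulAut.conj_apply]
    rw [fixCount_conj, smul_mul_assoc, mul_smul_comm, ← B.D_mul, ← B.D_mul, inv_mul_cancel_right]
  have htr : ∑ i, A i i = n ! * dimU N R := by
    rw [← sum_fixCount_mul_chi B]
    simp only [hA, Matrix.of_apply, OrthogonalForm.chi, Finset.mul_sum]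
    exact Finset.sum_comm
  have hdiag : A i i = (n ! : ℝ) * dimU N R / dimS R := by
    rw [Finset.sum_congr rfl fun k _ => B.matrix_diag_eq A hcomm k i] at htr
    simp only [Finset.sum_const, Finset.card_univ, Fintype.card_fin, nsmul_eq_mul] at htr
    rw [eq_div_iff (by exact_mod_cast (dimS_pos B R).ne'), mul_comm, htr]
  change A i j = _
  rw [B.matrix_eq_smul_one A hcomm, hdiag]

theorem sum_fixCount3_mul_D3 (N : ℕ) (p : Triple n) (i j : Idx3 p) :
    ∑ σ, fixCount3 N σ * B.D3 p σ i j =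
      if i = j then (kappa p)⁻¹ * (dimU N p.1 * dimU N p.2.1 * dimU N p.2.2) else 0 := by
  have h : ∀ σ : Perm3 n, fixCount3 N σ * B.D3 p σ i j =
      (fixCount N σ.1 * B.D p.1 σ.1 i.1 j.1) *
      (fixCount N σ.2.1 * B.D p.2.1 σ.2.1 i.2.1 j.2.1) *
      (fixCount N σ.2.2 * B.D p.2.2 σ.2.2 i.2.2 j.2.2) := fun σ => by
    simp only [OrthogonalForm.D3, fixCount3]
    ring
  simp_rw [h]
  rw [sum_prod_mul_mul (fun g => fixCount N g * B.D p.1 g i.1 j.1)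
    (fun g => fixCount N g * B.D p.2.1 g i.2.1 j.2.1)
    (fun g => fixCount N g * B.D p.2.2 g i.2.2 j.2.2),
    sum_fixCount_mul_D, sum_fixCount_mul_D, sum_fixCount_mul_D]
  by_cases h : i = j
  · subst h
    simp only [if_true, kappa, inv_div]
    ring
  · rw [if_neg h]
    simp only [Prod.ext_iff] at h
    by_cases h1 : i.1 = j.1
    · by_cases h2 : i.2.1 = j.2.1
      · rw [if_neg (c := i.2.2 = j.2.2) (by tauto), mul_zero]
      · rw [if_neg h2, mul_zero, zero_mul]
    · rw [if_neg h1, zero_mul, zero_mul]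

variable {B} (C : ClebschGordan B)

/-- The weighted sum of matrix elements is scalar, so only the inner product of the two invariant
vectors remains; `kappa` cancels. -/
theorem sum_fixCount3_mul_QunCoeff (N : ℕ) (p : Triple n) (τ τ' : Mult p) :
    ∑ σ, fixCount3 N σ * QunCoeff C p τ τ' σ =
      if τ = τ' then (dimS p.2.2 : ℝ) * (dimU N p.1 * dimU N p.2.1 * dimU N p.2.2) else 0 := by
  have hk := B.kappa_ne_zero p
  have h : ∀ σ, fixCount3 N σ * QunCoeff C p τ τ' σ = ∑ i, ∑ j,
      kappa p * C.vec p τ i * C.vec p τ' j * (fixCount3 N σ * B.D3 p σ i j) := by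
    intro σ
    rw [QunCoeff_eq, Finset.mul_sum, Finset.mul_sum]
    refine Finset.sum_congr rfl fun i _ => ?_
    rw [Finset.mul_sum, Finset.mul_sum]
    exact Finset.sum_congr rfl fun j _ => by ring
  simp_rw [h]
  rw [Finset.sum_comm, Finset.sum_congr rfl fun _ _ => Finset.sum_comm]
  simp_rw [← Finset.mul_sum, sum_fixCount3_mul_D3 B]
  simp only [mul_ite, mul_zero, Finset.sum_ite_eq, Finset.mem_univ, if_true]
  have h2 : ∀ i, kappa p * C.vec p τ i * C.vec p τ' i *
      ((kappa p)⁻¹ * (dimU N p.1 * dimU N p.2.1 * dimU N p.2.2)) =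
      C.vec p τ i * C.vec p τ' i * (dimU N p.1 * dimU N p.2.1 * dimU N p.2.2) := fun i => by
    field_simp
  simp_rw [h2, ← Finset.sum_mul, C.sum_vec_mul_vec]
  split_ifs <;> ring

/-- The two-point function of Fourier observables as a trace of a product. -/
theorem twoPoint_fourierObservable (N : ℕ) (p q : Triple n) (τ₁ τ₂ : Mult p) (τ₃ τ₄ : Mult q) :
    twoPoint (fourierObservable C N ⟨p, τ₁, τ₂⟩) (fourierObservable C N ⟨q, τ₃, τ₄⟩) =
      (((n ! : ℝ) ^ 2 * ∑ x : Perm3 n, fixCount3 N x *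
        ∑ σ, QunCoeff C p τ₁ τ₂ σ * QunCoeff C q τ₄ τ₃ (σ⁻¹ * x) : ℝ) : ℂ) := by
  have h1 : ∀ (r : Triple n) (τ τ' : Mult r), fourierObservable C N ⟨r, τ, τ'⟩ =
      ∑ σ, (QunCoeff C r τ τ' σ : ℂ) • permObservable N σ := fun r τ τ' =>
    observable_ofFun N _
  rw [h1, h1, twoPoint_sum_smul]
  simp_rw [twoPoint_permObservable]
  norm_cast
  have h2 : ∀ σ' : Perm3 n, ∀ α β : Equiv.Perm (Fin n),
      ∑ σ, QunCoeff C p τ₁ τ₂ σ * QunCoeff C q τ₃ τ₄ σ' *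
        fixCount3 N (diag α * σ * diag β * σ'⁻¹) =
      ∑ σ, QunCoeff C p τ₁ τ₂ σ * QunCoeff C q τ₃ τ₄ σ' * fixCount3 N (σ * σ'⁻¹) := by
    intro σ' α β
    -- Diagonal translations of `σ` leave the coefficient unchanged, so all `(n!)²` pairings
    -- contribute equally.
    rw [← Equiv.sum_comp ((Equiv.mulLeft (diag α)).trans (Equiv.mulRight (diag β)))
      fun σ => QunCoeff C p τ₁ τ₂ σ * QunCoeff C q τ₃ τ₄ σ' * fixCount3 N (σ * σ'⁻¹)]
    refine Finset.sum_congr rfl fun σ _ => ?_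
    simp only [Equiv.trans_apply, Equiv.coe_mulLeft, Equiv.coe_mulRight, QunCoeff_mul_diag,
      QunCoeff_diag_mul]
  have h3 : ∀ σ' : Perm3 n, ∑ σ, QunCoeff C p τ₁ τ₂ σ * QunCoeff C q τ₃ τ₄ σ' *
      (∑ α : Equiv.Perm (Fin n), ∑ β : Equiv.Perm (Fin n),
        fixCount3 N (diag α * σ * diag β * σ'⁻¹)) =
      (n ! : ℝ) ^ 2 *
        ∑ σ, QunCoeff C p τ₁ τ₂ σ * QunCoeff C q τ₃ τ₄ σ' * fixCount3 N (σ * σ'⁻¹) := by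
    intro σ'
    simp_rw [Finset.mul_sum]
    rw [Finset.sum_comm, Finset.sum_congr rfl fun _ _ => Finset.sum_comm]
    simp_rw [h2 σ']
    simp only [Finset.sum_const, Finset.card_univ, Fintype.card_perm, Fintype.card_fin,
      nsmul_eq_mul, Finset.mul_sum]
    exact Finset.sum_congr rfl fun σ _ => by ring
  rw [Finset.sum_comm, Finset.sum_congr rfl fun σ' _ => h3 σ', ← Finset.mul_sum]
  push_cast
  congr 1
  rw [Finset.sum_comm]
  simp_rw [Finset.mul_sum]
  rw [Finset.sum_comm (f := fun x σ => fixCount3 N x *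
    (QunCoeff C p τ₁ τ₂ σ * QunCoeff C q τ₄ τ₃ (σ⁻¹ * x)))]
  refine Finset.sum_congr rfl fun σ _ => ?_
  -- With `x = σ * σ'⁻¹` the second coefficient is evaluated at `σ'⁻¹`, which exchanges `τ₃` and
  -- `τ₄`.
  rw [← Equiv.sum_comp ((Equiv.inv (Perm3 n)).trans (Equiv.mulLeft σ)) fun x => fixCount3 N x *
    (QunCoeff C p τ₁ τ₂ σ * QunCoeff C q τ₄ τ₃ (σ⁻¹ * x))]
  refine Finset.sum_congr rfl fun σ' _ => ?_
  simp only [Equiv.trans_apply, Equiv.inv_apply, Equiv.coe_mulLeft, inv_mul_cancel_left,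
    QunCoeff_inv]
  ring

end

end

end TensorModel

theorem mainTheorem10 (n : ℕ) (B : TensorModel.OrthogonalForm n)
    (C : TensorModel.ClebschGordan B) :
    -- the elements `Q_un` form a basis of `𝒦(n)` and multiply like matrix units, up to `d(T)`
    (LinearIndependent ℂ (fun a : TensorModel.Label n => TensorModel.Qun C a.1 a.2.1 a.2.2) ∧
      Submodule.span ℂ
          (Set.range fun a : TensorModel.Label n => TensorModel.Qun C a.1 a.2.1 a.2.2) =
        TensorModel.doubleCosetSpace n ∧
      (∀ (p : TensorModel.Triple n) (τ₁ τ₂ τ₂' τ₃ : TensorModel.Mult p),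
        TensorModel.Qun C p τ₁ τ₂ * TensorModel.Qun C p τ₂' τ₃ =
          if τ₂ = τ₂' then (TensorModel.dimS p.2.2 : ℂ) • TensorModel.Qun C p τ₁ τ₃ else 0) ∧
      ∀ (p q : TensorModel.Triple n) (τ₁ τ₂ : TensorModel.Mult p) (τ₃ τ₄ : TensorModel.Mult q),
        p ≠ q → TensorModel.Qun C p τ₁ τ₂ * TensorModel.Qun C q τ₃ τ₄ = 0) ∧
    ∀ N : ℕ,
      -- the Fourier basis observables span the observables of degree `n`
      Submodule.span ℂ (Set.range (TensorModel.fourierObservable C N)) =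
        Submodule.span ℂ
          (Set.range (TensorModel.permObservable N : TensorModel.Perm3 n → _)) ∧
      -- and diagonalise the normal-ordered Gaussian two-point function
      ∀ a b : TensorModel.Label n,
        MeasureTheory.Integrable (fun Φ : TensorModel.Idx N → ℂ =>
          TensorModel.normalOrderedProduct (TensorModel.fourierObservable C N a)
            (TensorModel.fourierObservable C N b) Φ * TensorModel.gaussianWeight Φ) ∧
        TensorModel.twoPoint (TensorModel.fourierObservable C N a)
            (TensorModel.fourierObservable C N b) =
          if a = b then
            (n ! : ℂ) ^ 2 * (TensorModel.dimS a.1.2.2 : ℂ) ^ 2 *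
              (TensorModel.dimU N a.1.1 : ℂ) * (TensorModel.dimU N a.1.2.1 : ℂ) *
              (TensorModel.dimU N a.1.2.2 : ℂ)
          else 0 := by
  refine ⟨⟨TensorModel.linearIndependent_Qun C, TensorModel.span_Qun C,
    TensorModel.Qun_mul_Qun C, fun p q τ₁ τ₂ τ₃ τ₄ hpq =>
      TensorModel.Qun_mul_Qun_of_ne C hpq τ₁ τ₂ τ₃ τ₄⟩,
    fun N => ⟨TensorModel.span_fourierObservable C N, ?_⟩⟩
  rintro ⟨p, τ₁, τ₂⟩ ⟨q, τ₃, τ₄⟩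
  refine ⟨TensorModel.integrable_normalOrderedProduct _ _, ?_⟩
  rw [TensorModel.twoPoint_fourierObservable]
  by_cases hpq : p = q
  · subst hpq
    -- The product forces `τ₂ = τ₄` and gives one factor `d(T)`; the functional then forces `τ₁ =
    -- τ₃` and gives the second.
    simp_rw [TensorModel.sum_QunCoeff_mul_QunCoeff]
    by_cases h24 : τ₂ = τ₄
    · subst h24
      simp only [if_true]
      have h : ∑ x : TensorModel.Perm3 n, TensorModel.fixCount3 N x *
          ((TensorModel.dimS p.2.2 : ℝ) * TensorModel.QunCoeff C p τ₁ τ₃ x) =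
          TensorModel.dimS p.2.2 * ∑ x : TensorModel.Perm3 n, TensorModel.fixCount3 N x *
            TensorModel.QunCoeff C p τ₁ τ₃ x := by
        rw [Finset.mul_sum]
        exact Finset.sum_congr rfl fun x _ => by ring
      rw [h, TensorModel.sum_fixCount3_mul_QunCoeff]
      by_cases h13 : τ₁ = τ₃
      · subst h13
        rw [if_pos rfl, if_pos rfl]
        push_cast
        ring
      · rw [if_neg h13, if_neg]
        · simp
        · intro h
          simp only [Sigma.mk.injEq, heq_eq_eq, Prod.mk.injEq, true_and] at h
          exact h13 h.1
    · rw [if_neg (c := (⟨p, τ₁, τ₂⟩ : TensorModel.Label n) = ⟨p, τ₃, τ₄⟩)]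
      · simp [h24]
      · intro h
        simp only [Sigma.mk.injEq, heq_eq_eq, Prod.mk.injEq, true_and] at h
        exact h24 h.2
  · rw [if_neg fun h => hpq (congrArg Sigma.fst h)]
    simp_rw [TensorModel.sum_QunCoeff_mul_QunCoeff_of_ne C hpq]
    simp
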